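/- Let $n\ge 1$ and $p\ge 1$ be integers, and let $V=S^p\mathbb{R}^n$ be the space of real homogeneous polynomials of degree $p$ in $e_1,\dots,e_n$, equipped with the Bombieri inner product, for which the monomials $e_1^{\sigma_1}\cdots e_n^{\sigma_n}$ ($\sigma_1+\cdots+\sigma_n=p$) are orthogonal with squared norms $\sigma_1!\cdots\sigma_n!/p!$. Let $X\subset V$ be the manifold of non-zero symmetric tensors of rank one, that is, of the non-zero elements of the form $\pm u^p$ with $u=u_1e_1+\cdots+u_ne_n$, $(u_1,\dots,u_n)\in\mathbb{R}^n$. For $v\in V$ let $d_v(x)=\|v-x\|^2$. If $v$ is drawn from the standard Gaussian distribution on $V$ relative to the Bombieri inner product, then the number of critical points of the restriction $d_v|_X$ is a (completion-)measurable function of $v$, and its expectation is finite and equal to $$\frac{\sqrt{\pi}}{2^{(n-1)/2}\,\Gamma\!\left(\frac n2\right)}\;\mathbb{E}\left(\left|\det\left(\sqrt{p}\,w_0\,I-\sqrt{p-1}\,C(w_1)\right)\right|\right).$$ Here $I$ is the $(n-1)\times(n-1)$ identity matrix, $w_1=(w_{ij})_{2\le i\le j\le n}$, and $C(w_1)$ is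 the symmetric $(n-1)\times(n-1)$ matrix with diagonal entries $\sqrt2\,w_{ii}$ ($2\le i\le n$) and off-diagonal entries $w_{ij}$ ($2\le i<j\le n$); the real random variables $w_0$ and $w_{ij}$ ($2\le i\le j\le n$) are independent and standard normally distributed, and the absolute determinant is integrable. For $n=1$ the determinant of the empty matrix is $1$. -/

import Mathlib

open MeasureTheory ProbabilityTheory
open scoped Nat ENNReal ContDiff

noncomputable section

/-- The space `S^p ℝ^n` of symmetric tensors, i.e. of real homogeneous polynomials of degree `p`
in `n` variables. -/
def SymTensor (n p : ℕ) : Type := MvPolynomial.homogeneousSubmodule (Fin n) ℝ p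

namespace SymTensor

variable {n p : ℕ}

instance : AddCommGroup (SymTensor n p) :=
  inferInstanceAs (AddCommGroup (MvPolynomial.homogeneousSubmodule (Fin n) ℝ p))

instance : Module ℝ (SymTensor n p) :=
  inferInstanceAs (Module ℝ (MvPolynomial.homogeneousSubmodule (Fin n) ℝ p))

/-- The underlying polynomial of a symmetric tensor. -/
def toPoly : SymTensor n p →ₗ[ℝ] MvPolynomial (Fin n) ℝ :=
  (MvPolynomial.homogeneousSubmodule (Fin n) ℝ p).subtype

theorem toPoly_injective : Function.Injective (toPoly (n := n) (p := p)) :=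
  Subtype.val_injective

theorem isHomogeneous_toPoly (f : SymTensor n p) : (toPoly f).IsHomogeneous p :=
  f.2

/-- The finite set of exponents `σ ∈ ℕ^n` with `σ₁ + ⋯ + σₙ = p`. -/
def exponents (n p : ℕ) : Finset (Fin n →₀ ℕ) := Finset.finsuppAntidiag Finset.univ p

/-- The squared Bombieri norm `σ₁! ⋯ σₙ! / p!` of the monomial with exponent `σ`. -/
def monomialNormSq (p : ℕ) (σ : Fin n →₀ ℕ) : ℝ := (∏ i, ((σ i)! : ℝ)) / (p ! : ℝ)

theorem monomialNormSq_pos (p : ℕ) (σ : Fin n →₀ ℕ) : 0 < monomialNormSq p σ :=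
  div_pos (Finset.prod_pos fun i _ => by exact_mod_cast Nat.factorial_pos _)
    (by exact_mod_cast Nat.factorial_pos _)

/-- The Bombieri inner product: the monomials of degree `p` are orthogonal, with squared norms
`monomialNormSq p σ`. -/
def bombieriInner (f g : SymTensor n p) : ℝ :=
  ∑ σ ∈ exponents n p, monomialNormSq p σ * ((toPoly f).coeff σ * (toPoly g).coeff σ)

theorem eq_zero_of_bombieriInner_self (f : SymTensor n p) (h : bombieriInner f f = 0) :
    f = 0 := by
  apply toPoly_injective
  rw [map_zero]
  ext σ
  rw [MvPolynomial.coeff_zero]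
  by_contra hσ
  have hmem : σ ∈ exponents n p := by
    have hdeg : σ.degree = p := by
      by_contra hne
      exact hσ ((isHomogeneous_toPoly f).coeff_eq_zero hne)
    rw [Finsupp.degree_eq_sum] at hdeg
    simpa [exponents, Finset.mem_finsuppAntidiag] using hdeg
  have hz := (Finset.sum_eq_zero_iff_of_nonneg (fun τ _ =>
    mul_nonneg (monomialNormSq_pos p τ).le (mul_self_nonneg _))).1 h σ hmem
  exact (mul_pos (monomialNormSq_pos p σ) (mul_self_pos.2 hσ)).ne' hz

@[reducible]
def bombieriCore (n p : ℕ) : InnerProductSpace.Core ℝ (SymTensor n p) where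
  inner := bombieriInner
  conj_inner_symm f g := by
    simp [bombieriInner, mul_comm]
  re_inner_nonneg f := by
    simpa [bombieriInner] using Finset.sum_nonneg fun σ _ =>
      mul_nonneg (monomialNormSq_pos p σ).le (mul_self_nonneg ((toPoly f).coeff σ))
  add_left f g h := by
    simp only [bombieriInner, map_add, MvPolynomial.coeff_add, ← Finset.sum_add_distrib]
    exact Finset.sum_congr rfl fun σ _ => by ring
  smul_left f g r := by
    simp only [bombieriInner, map_smul, MvPolynomial.coeff_smul, Finset.mul_sum, smul_eq_mul,
      conj_trivial]
    exact Finset.sum_congr rfl fun σ _ => by ring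
  definite := eq_zero_of_bombieriInner_self

instance : NormedAddCommGroup (SymTensor n p) := (bombieriCore n p).toNormedAddCommGroup

instance : InnerProductSpace ℝ (SymTensor n p) :=
  InnerProductSpace.ofCore (bombieriCore n p).toCore

instance : FiniteDimensional ℝ (SymTensor n p) :=
  Module.Finite.iff_fg.2 (MvPolynomial.homogeneousSubmodule_fg (Fin n) ℝ p)

instance : MeasurableSpace (SymTensor n p) := borel _

instance : BorelSpace (SymTensor n p) := ⟨rfl⟩

/-- The pure power `u^p = (u₁ e₁ + ⋯ + uₙ eₙ)^p`. -/
def purePower (p : ℕ) (u : Fin n → ℝ) : SymTensor n p :=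
  ⟨(∑ i, MvPolynomial.C (u i) * MvPolynomial.X i) ^ p, by
    rw [MvPolynomial.mem_homogeneousSubmodule]
    have h : (∑ i, MvPolynomial.C (u i) * MvPolynomial.X i :
        MvPolynomial (Fin n) ℝ).IsHomogeneous 1 :=
      MvPolynomial.IsHomogeneous.sum _ _ _ fun i _ => by
        simpa using (MvPolynomial.isHomogeneous_C (Fin n) (u i)).mul
          (MvPolynomial.isHomogeneous_X ℝ i)
    simpa using h.pow p⟩

/-- The manifold `X` of nonzero symmetric tensors of rank one: those of the form `± u^p`. -/
def rankOne (n p : ℕ) : Set (SymTensor n p) :=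
  {x | x ≠ 0 ∧ ∃ u : Fin n → ℝ, x = purePower p u ∨ x = -purePower p u}

/-- The squared distance function `d_v(x) = ‖v - x‖²` for the Bombieri norm. -/
def sqDist (v x : SymTensor n p) : ℝ := ‖v - x‖ ^ 2

end SymTensor

/-- `x` is a critical point of `f` restricted to the submanifold `X` of `V`: the derivative of `f`
along every smooth curve in `X` through `x` vanishes at `x`. -/
def IsCriticalPointOn {V : Type*} [NormedAddCommGroup V] [NormedSpace ℝ V]
    (f : V → ℝ) (X : Set V) (x : V) : Prop :=
  x ∈ X ∧ ∀ γ : ℝ → V, ContDiffAt ℝ ∞ γ 0 → γ 0 = x → (∀ᶠ t in nhds (0 : ℝ), γ t ∈ X) →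
    HasDerivAt (fun t => f (γ t)) 0 0

/-- The number (possibly infinite) of critical points of `d_v` on the manifold of nonzero
symmetric tensors of rank one. -/
def criticalCount (n p : ℕ) (v : SymTensor n p) : ℝ≥0∞ :=
  ({x | IsCriticalPointOn (SymTensor.sqDist v) (SymTensor.rankOne n p) x}.encard : ℝ≥0∞)

/-- The symmetric `m × m` matrix `C(w)` with diagonal entries `√2 w_{ii}` and off-diagonal entries
`w_{ij}`, where `w` is indexed by unordered pairs. -/
def symGaussianMatrix (m : ℕ) (w : Sym2 (Fin m) → ℝ) : Matrix (Fin m) (Fin m) ℝ :=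
  Matrix.of fun i j => if i = j then √2 * w s(i, j) else w s(i, j)

/-- The joint law of the independent standard normal variables `w₀` and `w_{ij}`, `i ≤ j`. -/
def gaussianCoords (m : ℕ) : Measure (ℝ × (Sym2 (Fin m) → ℝ)) :=
  (gaussianReal 0 1).prod (Measure.pi fun _ => gaussianReal 0 1)

/-- The random variable `|det (√p w₀ I - √(p-1) C(w₁))|`. -/
def absDet (m p : ℕ) (w : ℝ × (Sym2 (Fin m) → ℝ)) : ℝ :=
  |((√(p : ℝ) * w.1) • (1 : Matrix (Fin m) (Fin m) ℝ)
    - √((p : ℝ) - 1) • symGaussianMatrix m w.2).det|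

end

/-!
A critical point `x = c u^p` of the distance to `v` on the rank-one locus, with `u` a unit vector,
is one where `v - x` is orthogonal to all `u^(p-1) w`. As the Bombieri product with `u^p` is
evaluation at `u` (`SymTensor.inner_purePower`), this says that `u` is a critical point, with
nonzero value `c`, of the polynomial function `v` on the unit sphere. The critical points are thus
counted by the set `critDirs v` of such `u`, each of them twice, by `u` and `-u`
(`SymTensor.encard_critDirs`).

The tensors with a critical point at the base point `e₁` form a linear subspace `W`, the orthogonal
complement of the `m = n - 1` unit tensors `√p e₁^(p-1) eⱼ`. Moving `W` by the reflection `H(y)` in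
the hyperplane orthogonal to `(1, y)`, `y ∈ ℝ^m`, gives a smooth map `param` from `ℝ^m × W`, which
is the whole space, to itself; the points over `v` with nonzero value at `e₁` correspond to the
critical directions of `v` other than `e₁` (`SymTensor.encard_param_preimage`). Since `H(y)` acts
by isometries, the Jacobian can be computed at the base point, where it is block triangular and
equals
`(2 / (1 + |y|²))^m |det (√p w₀ I - √(p-1) C(w₁))|` in orthonormal coordinates of `W`
(`SymTensor.abs_det_fderiv_param`). The area formula with multiplicity
(`lintegral_encard_preimage_mul`) turns the expected count into a Gaussian integral. There `y` is
independent of `w₀` and `w₁`, so it factors as a constant that depends only on `m` times the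
expected absolute determinant.

The constant need not be computed: for `p = 1` there is exactly one critical point, and the
expected absolute determinant is an absolute moment of one normal variable
(`lintegral_chartWeight_mul`). The cases `n = 1` and `p = 1`, where the rank-one tensors are all
the nonzero ones, are settled directly.
-/

/-! ### The area formula -/

section AreaFormula

variable {E : Type*} [NormedAddCommGroup E] [NormedSpace ℝ E] [FiniteDimensional ℝ E]

/-- By the inverse function theorem and the Lindelöf property, the set of regular points is covered
by countably many open sets on which the map is injective. -/
theorem exists_seq_isOpen_injOn_of_det_fderiv_ne_zero {f : E → E} (hf : ContDiff ℝ 1 f) :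
    ∃ U : ℕ → Set E, (∀ i, IsOpen (U i)) ∧ (∀ i, Set.InjOn f (U i)) ∧
      {x | (fderiv ℝ f x).det ≠ 0} ⊆ ⋃ i, U i := by
  have hloc : ∀ x : {x | (fderiv ℝ f x).det ≠ 0}, ∃ U : Set E, IsOpen U ∧ x.1 ∈ U ∧
      Set.InjOn f U := by
    rintro ⟨x, hx⟩
    have hs : HasStrictFDerivAt f
        (((fderiv ℝ f x).toContinuousLinearEquivOfDetNeZero hx : E ≃L[ℝ] E) : E →L[ℝ] E) x := by
      rw [ContinuousLinearMap.coe_toContinuousLinearEquivOfDetNeZero]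
      exact hf.contDiffAt.hasStrictFDerivAt one_ne_zero
    refine ⟨(hs.toOpenPartialHomeomorph f).source, (hs.toOpenPartialHomeomorph f).open_source,
      hs.mem_toOpenPartialHomeomorph_source, ?_⟩
    have := (hs.toOpenPartialHomeomorph f).injOn
    rwa [hs.toOpenPartialHomeomorph_coe] at this
  choose U hUo hxU hinj using hloc
  obtain ⟨T, hT, hTU⟩ := TopologicalSpace.isOpen_iUnion_countable U hUo
  have hcov : {x | (fderiv ℝ f x).det ≠ 0} ⊆ ⋃ i ∈ T, U i := by
    rw [hTU]
    exact fun x hx => Set.mem_iUnion.2 ⟨⟨x, hx⟩, hxU _⟩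
  rcases T.eq_empty_or_nonempty with rfl | hne
  · exact ⟨fun _ => ∅, fun _ => isOpen_empty, fun _ => Set.injOn_empty _, by simpa using hcov⟩
  · obtain ⟨g, rfl⟩ := hT.exists_eq_range hne
    refine ⟨fun i => U (g i), fun i => hUo _, fun i => hinj _, ?_⟩
    simpa using hcov

variable [MeasurableSpace E] [BorelSpace E]

/-- The **area formula** for a `C¹` self-map of a finite-dimensional space, counting preimages
with multiplicity. By Sard's theorem the critical set does not contribute; its complement is a
countable disjoint union of measurable sets on which the map is injective. -/
theorem lintegral_encard_preimage_mul (μ : Measure E) [μ.IsAddHaarMeasure] {f : E → E}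
    (hf : ContDiff ℝ 1 f) {s : Set E} (hs : MeasurableSet s) {g : E → ℝ≥0∞} (hg : Measurable g) :
    AEMeasurable (fun v => ((s ∩ f ⁻¹' {v}).encard : ℝ≥0∞)) μ ∧
    ∫⁻ v, ((s ∩ f ⁻¹' {v}).encard : ℝ≥0∞) * g v ∂μ =
      ∫⁻ x in s, ENNReal.ofReal |(fderiv ℝ f x).det| * g (f x) ∂μ := by
  have hcont : Continuous fun x => (fderiv ℝ f x).det :=
    ContinuousLinearMap.continuous_det.comp (hf.continuous_fderiv one_ne_zero)
  have hder : ∀ x, HasFDerivAt f (fderiv ℝ f x) x := fun x =>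
    (hf.differentiable one_ne_zero x).hasFDerivAt
  obtain ⟨U, hUo, hinj, hcov⟩ := exists_seq_isOpen_injOn_of_det_fderiv_ne_zero hf
  set R : Set E := s ∩ {x | (fderiv ℝ f x).det ≠ 0} with hR
  set Z : Set E := s ∩ {x | (fderiv ℝ f x).det = 0} with hZ
  have hRm : MeasurableSet R := hs.inter (isOpen_ne_fun hcont continuous_const).measurableSet
  have hZm : MeasurableSet Z := hs.inter (isClosed_eq hcont continuous_const).measurableSet
  set P : ℕ → Set E := fun i => R ∩ disjointed U i with hP
  have hPm : ∀ i, MeasurableSet (P i) := fun i =>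
    hRm.inter (MeasurableSet.disjointed (fun i => (hUo i).measurableSet) i)
  have hPinj : ∀ i, Set.InjOn f (P i) := fun i =>
    (hinj i).mono fun x hx => disjointed_subset U i hx.2
  have hPdisj : Pairwise (Function.onFun Disjoint P) := fun i j hij =>
    (disjoint_disjointed U hij).mono Set.inter_subset_right Set.inter_subset_right
  have hPU : ⋃ i, P i = R := by
    rw [hP, ← Set.inter_iUnion, iUnion_disjointed]
    exact Set.inter_eq_left.2 fun x hx => hcov hx.2
  have hfib : ∀ v, MeasurableSet (f ⁻¹' {v}) := fun v =>
    hf.continuous.measurable (measurableSet_singleton v)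
  have him : ∀ i, MeasurableSet (f '' P i) := fun i =>
    (hPm i).image_of_continuousOn_injOn hf.continuous.continuousOn (hPinj i)
  have hcount : ∀ i v, Measure.count (P i ∩ f ⁻¹' {v}) =
      (f '' P i).indicator (fun _ => (1 : ℝ≥0∞)) v := by
    intro i v
    by_cases hv : v ∈ f '' P i
    · obtain ⟨x, hx, rfl⟩ := hv
      have : P i ∩ f ⁻¹' {f x} = {x} := by
        ext y
        constructor
        · rintro ⟨hy, hyx⟩
          exact hPinj i hy hx hyx
        · rintro rfl
          exact ⟨hx, rfl⟩
      rw [this, Set.indicator_of_mem (Set.mem_image_of_mem f hx), Measure.count_singleton]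
    · have : P i ∩ f ⁻¹' {v} = ∅ := by
        ext y
        simp only [Set.mem_inter_iff, Set.mem_preimage, Set.mem_singleton_iff,
          Set.mem_empty_iff_false, iff_false, not_and]
        exact fun hy hyv => hv ⟨y, hy, hyv⟩
      rw [this, Set.indicator_of_notMem hv, measure_empty]
  have hZnull : μ (f '' Z) = 0 :=
    addHaar_image_eq_zero_of_det_fderivWithin_eq_zero μ
      (fun x _ => (hder x).hasFDerivWithinAt) fun x hx => hx.2
  have hae : (fun v => ((s ∩ f ⁻¹' {v}).encard : ℝ≥0∞)) =ᵐ[μ]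
      fun v => ∑' i, (f '' P i).indicator (fun _ => (1 : ℝ≥0∞)) v := by
    filter_upwards [compl_mem_ae_iff.2 hZnull] with v hv
    have hsv : s ∩ f ⁻¹' {v} = ⋃ i, P i ∩ f ⁻¹' {v} := by
      rw [← Set.iUnion_inter, hPU]
      ext x
      constructor
      · rintro ⟨hx, hxv⟩
        exact ⟨⟨hx, fun h0 => hv ⟨x, ⟨hx, h0⟩, hxv⟩⟩, hxv⟩
      · rintro ⟨hx, hxv⟩
        exact ⟨hx.1, hxv⟩
    rw [← Measure.count_apply (hs.inter (hfib v)), hsv, measure_iUnion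
      (fun i j hij => (hPdisj hij).mono Set.inter_subset_left Set.inter_subset_left)
      (fun i => (hPm i).inter (hfib v))]
    exact tsum_congr fun i => hcount i v
  have hmeas : Measurable fun v => ∑' i, (f '' P i).indicator (fun _ => (1 : ℝ≥0∞)) v :=
    Measurable.tsum fun i => measurable_const.indicator (him i)
  refine ⟨hmeas.aemeasurable.congr hae.symm, ?_⟩
  calc ∫⁻ v, ((s ∩ f ⁻¹' {v}).encard : ℝ≥0∞) * g v ∂μ
      = ∫⁻ v, ∑' i, (f '' P i).indicator g v ∂μ := by
        refine lintegral_congr_ae ?_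
        filter_upwards [hae] with v hv
        rw [hv, ← ENNReal.tsum_mul_right]
        refine tsum_congr fun i => ?_
        by_cases h : v ∈ f '' P i <;> simp [h]
    _ = ∑' i, ∫⁻ v in f '' P i, g v ∂μ := by
        rw [lintegral_tsum fun i => (hg.indicator (him i)).aemeasurable]
        exact tsum_congr fun i => lintegral_indicator (him i) _
    _ = ∑' i, ∫⁻ x in P i, ENNReal.ofReal |(fderiv ℝ f x).det| * g (f x) ∂μ :=
        tsum_congr fun i => lintegral_image_eq_lintegral_abs_det_fderiv_mul μ (hPm i)
          (fun x _ => (hder x).hasFDerivWithinAt) (hPinj i) g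
    _ = ∫⁻ x in R, ENNReal.ofReal |(fderiv ℝ f x).det| * g (f x) ∂μ := by
        rw [← lintegral_iUnion hPm hPdisj, hPU]
    _ = ∫⁻ x in s, ENNReal.ofReal |(fderiv ℝ f x).det| * g (f x) ∂μ := by
        have hunion : R ∪ Z = s := by
          rw [hR, hZ, ← Set.inter_union_distrib_left]
          exact Set.inter_eq_left.2 fun x _ => (em _).symm
        have hdisj : Disjoint R Z := Set.disjoint_left.2 fun x hx hx' => hx.2 hx'.2
        rw [← hunion, lintegral_union hZm hdisj]
        have : ∫⁻ x in Z, ENNReal.ofReal |(fderiv ℝ f x).det| * g (f x) ∂μ = 0 := by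
          rw [setLIntegral_congr_fun hZm (g := fun _ => 0) fun x hx => by
            simp [show (fderiv ℝ f x).det = 0 from hx.2]]
          simp
        rw [this, add_zero]

end AreaFormula

/-! ### The standard Gaussian measure -/

section Gaussian

variable {V : Type*} [NormedAddCommGroup V] [InnerProductSpace ℝ V]

/-- The Lebesgue density of the standard Gaussian measure. -/
noncomputable def gaussianDensity (V : Type*) [NormedAddCommGroup V] [InnerProductSpace ℝ V]
    (v : V) : ℝ :=
  ((2 * Real.pi) ^ ((Module.finrank ℝ V : ℝ) / 2))⁻¹ * Real.exp (-‖v‖ ^ 2 / 2)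

theorem gaussianDensity_nonneg (v : V) : 0 ≤ gaussianDensity V v := by
  unfold gaussianDensity; positivity

variable [MeasurableSpace V] [BorelSpace V]

theorem measurable_gaussianDensity : Measurable (gaussianDensity V) := by
  unfold gaussianDensity; fun_prop

variable [FiniteDimensional ℝ V]

/-- The characteristic function of the Gaussian density. -/
theorem integral_cexp_mul_gaussianDensity (t : V) :
    ∫ v : V, gaussianDensity V v • Complex.exp (inner ℝ v t * Complex.I) =
      Complex.exp (-‖t‖ ^ 2 / 2) := by
  have h := GaussianFourier.integral_cexp_neg_mul_sq_norm_add (V := V) (b := 1 / 2)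
    (by norm_num) Complex.I t
  have h2 : ∀ v : V, gaussianDensity V v • Complex.exp (inner ℝ v t * Complex.I) =
      ((((2 * Real.pi) ^ ((Module.finrank ℝ V : ℝ) / 2))⁻¹ : ℝ) : ℂ) *
        Complex.exp (-(1 / 2) * ‖v‖ ^ 2 + Complex.I * inner ℝ t v) := by
    intro v
    rw [gaussianDensity, Complex.real_smul, Complex.ofReal_mul, mul_assoc, Complex.ofReal_exp,
      ← Complex.exp_add, real_inner_comm]
    congr 2
    push_cast
    ring
  simp_rw [h2]
  rw [integral_const_mul, h]
  have h3 : ((Real.pi : ℂ) / (1 / 2)) ^ ((Module.finrank ℝ V : ℂ) / 2) =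
      (((2 * Real.pi) ^ ((Module.finrank ℝ V : ℝ) / 2) : ℝ) : ℂ) := by
    rw [Complex.ofReal_cpow (by positivity)]
    congr 1 <;> push_cast <;> ring
  rw [h3, ← mul_assoc, ← Complex.ofReal_mul, inv_mul_cancel₀ (by positivity), Complex.ofReal_one,
    one_mul, Complex.I_sq]
  congr 1
  ring

theorem integral_gaussianDensity : ∫ v : V, gaussianDensity V v = 1 := by
  have h := integral_cexp_mul_gaussianDensity (0 : V)
  simp only [inner_zero_right, Complex.ofReal_zero, zero_mul, Complex.exp_zero, norm_zero,
    Complex.real_smul, mul_one] at h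
  rw [integral_complex_ofReal] at h
  have : ((∫ v : V, gaussianDensity V v : ℝ) : ℂ) = 1 := by simpa using h
  exact_mod_cast this

theorem stdGaussian_eq_withDensity :
    stdGaussian V = (volume : Measure V).withDensity
      fun v => ENNReal.ofReal (gaussianDensity V v) := by
  have hint : Integrable (gaussianDensity V) (volume : Measure V) := by
    by_contra h
    have := integral_undef h
    rw [integral_gaussianDensity] at this
    exact one_ne_zero this
  have : IsFiniteMeasure ((volume : Measure V).withDensity
      fun v => ENNReal.ofReal (gaussianDensity V v)) := by
    refine ⟨?_⟩
    rw [withDensity_apply _ MeasurableSet.univ, setLIntegral_univ]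
    exact hint.lintegral_lt_top
  apply Measure.ext_of_charFun
  ext t
  rw [charFun_stdGaussian, charFun_apply,
    integral_withDensity_eq_integral_toReal_smul measurable_gaussianDensity.ennreal_ofReal
      (by simp), ← integral_cexp_mul_gaussianDensity]
  simp_rw [ENNReal.toReal_ofReal (gaussianDensity_nonneg _)]

/-- The coordinates of a standard Gaussian vector along an orthonormal family are independent
standard normal variables. -/
theorem map_inner_stdGaussian_eq_pi {J : Type*} [Fintype J] {e : J → V} (he : Orthonormal ℝ e) :
    (stdGaussian V).map (fun v j => inner ℝ (e j) v) = Measure.pi fun _ => gaussianReal 0 1 := by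
  have hm : Measurable fun (v : V) j => inner ℝ (e j) v := by fun_prop
  have : IsProbabilityMeasure ((stdGaussian V).map (fun v j => inner ℝ (e j) v)) :=
    Measure.isProbabilityMeasure_map hm.aemeasurable
  have key : ((stdGaussian V).map (fun v j => inner ℝ (e j) v)).map (WithLp.toLp 2) =
      stdGaussian (EuclideanSpace ℝ J) := by
    rw [Measure.map_map (by fun_prop) hm]
    have : IsProbabilityMeasure
        ((stdGaussian V).map (WithLp.toLp 2 ∘ fun v j => inner ℝ (e j) v)) :=
      Measure.isProbabilityMeasure_map (by fun_prop)
    apply Measure.ext_of_charFun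
    ext t
    rw [charFun_stdGaussian, charFun_apply, integral_map (by fun_prop) (by fun_prop)]
    have h : ∀ v : V, inner ℝ ((WithLp.toLp 2 ∘ fun v j => inner ℝ (e j) v) v :
        EuclideanSpace ℝ J) t = inner ℝ v (∑ j, t j • e j) := by
      intro v
      simp [PiLp.inner_apply, inner_sum, inner_smul_right, real_inner_comm]
    simp_rw [h]
    rw [← charFun_apply, charFun_stdGaussian]
    congr 2
    have hn : ‖∑ j, t j • e j‖ ^ 2 = ‖t‖ ^ 2 := by
      rw [← real_inner_self_eq_norm_sq, he.inner_sum, EuclideanSpace.real_norm_sq_eq]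
      simp [sq]
    exact_mod_cast congrArg (fun r : ℝ => -(r : ℂ)) hn
  have h2 := congrArg (fun μ => Measure.map (WithLp.ofLp) μ)
    (key.trans map_pi_eq_stdGaussian.symm)
  have h3 : (WithLp.ofLp ∘ WithLp.toLp 2 : (J → ℝ) → J → ℝ) = id := rfl
  simpa only [Measure.map_map (WithLp.measurable_ofLp 2 (J → ℝ)) (WithLp.measurable_toLp 2 (J → ℝ)),
    h3, Measure.map_id] using h2

end Gaussian

/-! ### Polynomial functions -/

section Polynomial

variable {n : ℕ}

theorem MvPolynomial.hasFDerivAt_eval (P : MvPolynomial (Fin n) ℝ) (u : Fin n → ℝ) :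
    HasFDerivAt (fun u => MvPolynomial.eval u P)
      (∑ i, MvPolynomial.eval u (MvPolynomial.pderiv i P) •
        (ContinuousLinearMap.proj i : (Fin n → ℝ) →L[ℝ] ℝ)) u := by
  induction P using MvPolynomial.induction_on with
  | C a => simpa using hasFDerivAt_const a u
  | add P Q hP hQ => simpa [add_smul, Finset.sum_add_distrib] using hP.fun_add hQ
  | mul_X P j hP =>
    have h := hP.mul (hasFDerivAt_apply (𝕜 := ℝ) j u)
    simp only [map_mul, MvPolynomial.eval_X]
    convert! h using 1
    simp only [MvPolynomial.pderiv_mul, map_add, map_mul, MvPolynomial.eval_X, add_smul,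
      Finset.sum_add_distrib, Finset.smul_sum, smul_smul]
    rw [add_comm]
    congr 1
    · simp [MvPolynomial.pderiv_X, Pi.single_apply, apply_ite (MvPolynomial.eval u)]
    · exact Finset.sum_congr rfl fun i _ => by rw [mul_comm]

theorem MvPolynomial.contDiff_eval (P : MvPolynomial (Fin n) ℝ) {k : WithTop ℕ∞} :
    ContDiff ℝ k (fun u => MvPolynomial.eval u P) := by
  induction P using MvPolynomial.induction_on with
  | C a => simpa using contDiff_const
  | add P Q hP hQ => simpa using hP.add hQ
  | mul_X P j hP => simpa using hP.mul (contDiff_apply ℝ ℝ j)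

theorem MvPolynomial.IsHomogeneous.eval_smul {P : MvPolynomial (Fin n) ℝ} {d : ℕ}
    (hP : P.IsHomogeneous d) (c : ℝ) (u : Fin n → ℝ) :
    MvPolynomial.eval (c • u) P = c ^ d * MvPolynomial.eval u P := by
  rw [MvPolynomial.eval_eq, MvPolynomial.eval_eq, Finset.mul_sum]
  refine Finset.sum_congr rfl fun σ hσ => ?_
  have hd : ∏ i ∈ σ.support, c ^ σ i = c ^ d := by
    rw [Finset.prod_pow_eq_pow_sum, hP.degree_eq_sum_deg_support hσ]
  simp only [Pi.smul_apply, smul_eq_mul, mul_pow, Finset.prod_mul_distrib]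
  rw [hd]
  ring

/-- A homogeneous polynomial evaluated at a coordinate vector is the coefficient of the
corresponding pure power. -/
theorem MvPolynomial.IsHomogeneous.eval_single_one {P : MvPolynomial (Fin n) ℝ} {d : ℕ}
    (hP : P.IsHomogeneous d) (i : Fin n) :
    MvPolynomial.eval (Pi.single i 1) P = P.coeff (Finsupp.single i d) := by
  rw [MvPolynomial.eval_eq, Finset.sum_eq_single (Finsupp.single i d)]
  · rw [Finset.prod_eq_one, mul_one]
    intro j hj
    have : j = i := by
      by_contra hne
      simp [Ne.symm hne] at hj
    simp [this]
  · intro σ hσ hne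
    have : ∃ j ∈ σ.support, j ≠ i := by
      by_contra! hcon
      apply hne
      have h1 : σ = Finsupp.single i (σ i) := by
        ext j
        by_cases hj : j = i
        · simp [hj]
        · have : j ∉ σ.support := fun h => hj (hcon j h)
          rw [Finsupp.notMem_support_iff.1 this, Finsupp.single_eq_of_ne hj]
      have h2 := hP.degree_eq_sum_deg_support hσ
      rw [← Finsupp.degree_apply, h1, Finsupp.degree_single] at h2
      rw [h1, h2]
    obtain ⟨j, hj, hji⟩ := this
    rw [Finset.prod_eq_zero hj, mul_zero]
    rw [Pi.single_eq_of_ne hji, zero_pow (Finsupp.mem_support_iff.1 hj)]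
  · intro h
    rw [MvPolynomial.notMem_support_iff.1 h, zero_mul]

theorem MvPolynomial.coeff_sum_C_mul_X_pow (u : Fin n → ℝ) (p : ℕ) {σ : Fin n →₀ ℕ}
    (hσ : ∑ i, σ i = p) :
    ((∑ i, MvPolynomial.C (u i) * MvPolynomial.X i : MvPolynomial (Fin n) ℝ) ^ p).coeff σ =
      (Nat.multinomial Finset.univ σ : ℝ) * ∏ i, u i ^ σ i := by
  rw [Finset.sum_pow_eq_sum_piAntidiag, MvPolynomial.coeff_sum]
  have hterm : ∀ k : Fin n → ℕ,
      ((Nat.multinomial Finset.univ k : MvPolynomial (Fin n) ℝ) *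
        ∏ i, (MvPolynomial.C (u i) * MvPolynomial.X i) ^ k i) =
      MvPolynomial.monomial (Finsupp.equivFunOnFinite.symm k)
        ((Nat.multinomial Finset.univ k : ℝ) * ∏ i, u i ^ k i) := by
    intro k
    rw [MvPolynomial.monomial_eq, Finsupp.prod_fintype _ _ (by simp)]
    simp only [mul_pow, Finset.prod_mul_distrib, map_mul, map_natCast, map_prod, map_pow,
      Finsupp.equivFunOnFinite_symm_apply_apply]
    ring
  simp_rw [hterm, MvPolynomial.coeff_monomial]
  rw [Finset.sum_eq_single (σ : Fin n → ℕ)]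
  · simp
  · intro k _ hk
    rw [if_neg]
    rintro rfl
    exact hk rfl
  · intro h
    exact absurd (by simp [Finset.mem_piAntidiag, hσ]) h

end Polynomial

/-! ### Symmetric tensors as polynomial functions -/

namespace SymTensor

variable {n p : ℕ}

/-- The value at `u` of a symmetric tensor, seen as a polynomial function. -/
noncomputable def evalAt (u : Fin n → ℝ) : SymTensor n p →ₗ[ℝ] ℝ :=
  (MvPolynomial.aeval u : MvPolynomial (Fin n) ℝ →ₐ[ℝ] ℝ).toLinearMap ∘ₗ toPoly

/-- The `i`-th partial derivative at `u` of a symmetric tensor, seen as a polynomial function. -/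
noncomputable def grad (i : Fin n) (u : Fin n → ℝ) : SymTensor n p →ₗ[ℝ] ℝ :=
  (MvPolynomial.aeval u : MvPolynomial (Fin n) ℝ →ₐ[ℝ] ℝ).toLinearMap ∘ₗ
    (MvPolynomial.pderiv i : Derivation ℝ (MvPolynomial (Fin n) ℝ) _).toLinearMap ∘ₗ toPoly

/-- The second partial derivative `∂ᵢ∂ⱼ` at `u` of a symmetric tensor. -/
noncomputable def hess (i j : Fin n) (u : Fin n → ℝ) : SymTensor n p →ₗ[ℝ] ℝ :=
  (MvPolynomial.aeval u : MvPolynomial (Fin n) ℝ →ₐ[ℝ] ℝ).toLinearMap ∘ₗ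
    (MvPolynomial.pderiv i : Derivation ℝ (MvPolynomial (Fin n) ℝ) _).toLinearMap ∘ₗ
    (MvPolynomial.pderiv j : Derivation ℝ (MvPolynomial (Fin n) ℝ) _).toLinearMap ∘ₗ toPoly

theorem evalAt_apply (u : Fin n → ℝ) (v : SymTensor n p) :
    evalAt u v = MvPolynomial.eval u (toPoly v) := by
  simp [evalAt, MvPolynomial.aeval_eq_eval]

theorem grad_apply (i : Fin n) (u : Fin n → ℝ) (v : SymTensor n p) :
    grad i u v = MvPolynomial.eval u (MvPolynomial.pderiv i (toPoly v)) := by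
  simp [grad, MvPolynomial.aeval_eq_eval]

theorem hess_apply (i j : Fin n) (u : Fin n → ℝ) (v : SymTensor n p) :
    hess i j u v =
      MvPolynomial.eval u (MvPolynomial.pderiv i (MvPolynomial.pderiv j (toPoly v))) := by
  simp [hess, MvPolynomial.aeval_eq_eval]

theorem toPoly_purePower (u : Fin n → ℝ) :
    toPoly (purePower p u) = (∑ i, MvPolynomial.C (u i) * MvPolynomial.X i) ^ p := rfl

theorem evalAt_purePower (u x : Fin n → ℝ) :
    evalAt x (purePower p u) = (u ⬝ᵥ x) ^ p := by
  simp [evalAt_apply, toPoly_purePower, dotProduct]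

theorem grad_purePower (i : Fin n) (u x : Fin n → ℝ) :
    grad i x (purePower p u) = p * (u ⬝ᵥ x) ^ (p - 1) * u i := by
  simp [grad_apply, toPoly_purePower, dotProduct, MvPolynomial.pderiv_X, Pi.single_apply, mul_assoc]

theorem evalAt_smul (c : ℝ) (u : Fin n → ℝ) (v : SymTensor n p) :
    evalAt (c • u) v = c ^ p * evalAt u v := by
  rw [evalAt_apply, evalAt_apply, (isHomogeneous_toPoly v).eval_smul]

theorem grad_smul (i : Fin n) (c : ℝ) (u : Fin n → ℝ) (v : SymTensor n p) :
    grad i (c • u) v = c ^ (p - 1) * grad i u v := by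
  rw [grad_apply, grad_apply, (isHomogeneous_toPoly v).pderiv.eval_smul]

/-- Euler's identity. -/
theorem sum_mul_grad (u : Fin n → ℝ) (v : SymTensor n p) :
    ∑ i, u i * grad i u v = p * evalAt u v := by
  have h := congrArg (MvPolynomial.eval u) (isHomogeneous_toPoly v).sum_X_mul_pderiv
  simpa [grad_apply, evalAt_apply] using h

theorem hasFDerivAt_evalAt (v : SymTensor n p) (u : Fin n → ℝ) :
    HasFDerivAt (fun u => evalAt u v)
      (∑ i, grad i u v • (ContinuousLinearMap.proj i : (Fin n → ℝ) →L[ℝ] ℝ)) u := by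
  simp only [evalAt_apply, grad_apply]
  exact MvPolynomial.hasFDerivAt_eval _ _

theorem hasFDerivAt_grad (v : SymTensor n p) (j : Fin n) (u : Fin n → ℝ) :
    HasFDerivAt (fun u => grad j u v)
      (∑ i, hess i j u v • (ContinuousLinearMap.proj i : (Fin n → ℝ) →L[ℝ] ℝ)) u := by
  simp only [hess_apply, grad_apply]
  exact MvPolynomial.hasFDerivAt_eval _ _

theorem ext_evalAt {v w : SymTensor n p} (h : ∀ u, evalAt u v = evalAt u w) : v = w :=
  toPoly_injective (MvPolynomial.funext fun u => by simpa [evalAt_apply] using h u)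

theorem inner_def (v w : SymTensor n p) : inner ℝ v w = bombieriInner v w := rfl

theorem mem_exponents {σ : Fin n →₀ ℕ} : σ ∈ exponents n p ↔ ∑ i, σ i = p := by
  simp [exponents, Finset.mem_finsuppAntidiag]

/-- The reproducing property of the Bombieri inner product. -/
theorem inner_purePower (v : SymTensor n p) (u : Fin n → ℝ) :
    inner ℝ v (purePower p u) = evalAt u v := by
  rw [inner_def, bombieriInner, evalAt_apply, MvPolynomial.eval_eq']
  have hsub : (toPoly v).support ⊆ exponents n p := by
    intro σ hσ
    rw [mem_exponents, (isHomogeneous_toPoly v).degree_eq_sum_deg_support hσ]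
    exact (Finset.sum_subset (Finset.subset_univ _) (by simp)).symm
  rw [Finset.sum_subset hsub fun σ _ hσ => by
    rw [MvPolynomial.notMem_support_iff.1 hσ, zero_mul]]
  refine Finset.sum_congr rfl fun σ hσ => ?_
  rw [mem_exponents] at hσ
  rw [toPoly_purePower, MvPolynomial.coeff_sum_C_mul_X_pow u p hσ]
  have h := Nat.multinomial_spec Finset.univ σ
  rw [hσ] at h
  have h' : (∏ i, ((σ i)! : ℝ)) * Nat.multinomial Finset.univ σ = p ! := by exact_mod_cast h
  have hp : (p ! : ℝ) ≠ 0 := by positivity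
  calc monomialNormSq p σ * ((toPoly v).coeff σ *
        ((Nat.multinomial Finset.univ σ : ℝ) * ∏ i, u i ^ σ i))
      = (∏ i, ((σ i)! : ℝ)) * Nat.multinomial Finset.univ σ / p ! *
          ((toPoly v).coeff σ * ∏ i, u i ^ σ i) := by rw [monomialNormSq]; ring
    _ = _ := by rw [h', div_self hp, one_mul]

theorem span_range_purePower :
    Submodule.span ℝ (Set.range (purePower p : (Fin n → ℝ) → SymTensor n p)) = ⊤ := by
  rw [← Submodule.orthogonal_eq_bot_iff, Submodule.eq_bot_iff]
  intro v hv
  refine ext_evalAt fun u => ?_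
  rw [← inner_purePower, ← inner_purePower, inner_zero_left, real_inner_comm]
  exact (Submodule.mem_orthogonal _ _).1 hv _ (Submodule.subset_span ⟨u, rfl⟩)

/-- A map into symmetric tensors is smooth as soon as its values at all points are, since the
pure powers span the space. -/
theorem contDiff_of_evalAt {F : Type*} [NormedAddCommGroup F] [NormedSpace ℝ F]
    {f : F → SymTensor n p} {k : WithTop ℕ∞} (h : ∀ u, ContDiff ℝ k fun x => evalAt u (f x)) :
    ContDiff ℝ k f := by
  have key : ∀ w : SymTensor n p, ContDiff ℝ k fun x => inner ℝ (f x) w := by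
    intro w
    have hw : w ∈ Submodule.span ℝ (Set.range (purePower p : (Fin n → ℝ) → SymTensor n p)) := by
      rw [span_range_purePower]; trivial
    induction hw using Submodule.span_induction with
    | mem w hw =>
      obtain ⟨u, rfl⟩ := hw
      simpa only [inner_purePower] using h u
    | zero => simpa using contDiff_const
    | add w w' _ _ hw hw' => simpa only [inner_add_right] using hw.add hw'
    | smul c w _ hw => simpa only [inner_smul_right] using contDiff_const.mul hw
  have hsum : f = fun x => ∑ i, inner ℝ (f x) (stdOrthonormalBasis ℝ (SymTensor n p) i) •
      stdOrthonormalBasis ℝ (SymTensor n p) i := by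
    funext x
    simp_rw [real_inner_comm (stdOrthonormalBasis ℝ (SymTensor n p) _)]
    exact ((stdOrthonormalBasis ℝ (SymTensor n p)).sum_repr' (f x)).symm
  rw [hsum]
  exact ContDiff.sum fun i _ => (key _).smul contDiff_const

/-- Linear substitution: `subst A v` is the polynomial function `u ↦ v (A u)`. -/
noncomputable def subst (A : Matrix (Fin n) (Fin n) ℝ) : SymTensor n p →ₗ[ℝ] SymTensor n p :=
  LinearMap.restrict (p := MvPolynomial.homogeneousSubmodule (Fin n) ℝ p)
    (q := MvPolynomial.homogeneousSubmodule (Fin n) ℝ p)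
    (MvPolynomial.aeval fun i => ∑ j, MvPolynomial.C (A i j) * MvPolynomial.X j :
      MvPolynomial (Fin n) ℝ →ₐ[ℝ] MvPolynomial (Fin n) ℝ).toLinearMap fun v hv => by
    rw [MvPolynomial.mem_homogeneousSubmodule] at hv ⊢
    have h : ∀ i, (∑ j, MvPolynomial.C (A i j) * MvPolynomial.X j :
        MvPolynomial (Fin n) ℝ).IsHomogeneous 1 := fun i =>
      MvPolynomial.IsHomogeneous.sum _ _ _ fun j _ => MvPolynomial.isHomogeneous_C_mul_X _ _
    simpa using hv.aeval _ h

theorem toPoly_subst (A : Matrix (Fin n) (Fin n) ℝ) (v : SymTensor n p) :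
    toPoly (subst A v) = MvPolynomial.bind₁
      (fun i => ∑ j, MvPolynomial.C (A i j) * MvPolynomial.X j) (toPoly v) := rfl

theorem evalAt_subst (A : Matrix (Fin n) (Fin n) ℝ) (v : SymTensor n p) (u : Fin n → ℝ) :
    evalAt u (subst A v) = evalAt (A.mulVec u) v := by
  rw [evalAt_apply, evalAt_apply, toPoly_subst]
  induction toPoly v using MvPolynomial.induction_on with
  | C a => simp
  | add P Q hP hQ => simp [hP, hQ]
  | mul_X P i hP => simp [hP, Matrix.mulVec, dotProduct]

theorem subst_subst (A B : Matrix (Fin n) (Fin n) ℝ) (v : SymTensor n p) :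
    subst A (subst B v) = subst (B * A) v :=
  ext_evalAt fun u => by simp [evalAt_subst, Matrix.mulVec_mulVec]

@[simp]
theorem subst_one (v : SymTensor n p) : subst 1 v = v :=
  ext_evalAt fun u => by simp [evalAt_subst]

/-- Substituting `A` acts on pure powers through the transpose, so that its adjoint for the
Bombieri product is the substitution of the transpose. -/
theorem subst_purePower (A : Matrix (Fin n) (Fin n) ℝ) (u : Fin n → ℝ) :
    subst A (purePower p u) = purePower p (A.transpose.mulVec u) :=
  ext_evalAt fun x => by
    rw [evalAt_subst, evalAt_purePower, evalAt_purePower, Matrix.dotProduct_mulVec,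
      Matrix.mulVec_transpose]

theorem inner_subst_left (A : Matrix (Fin n) (Fin n) ℝ) (v w : SymTensor n p) :
    inner ℝ (subst A v) w = inner ℝ v (subst A.transpose w) := by
  have hw : w ∈ Submodule.span ℝ (Set.range (purePower p : (Fin n → ℝ) → SymTensor n p)) := by
    rw [span_range_purePower]; trivial
  induction hw using Submodule.span_induction with
  | mem w hw =>
    obtain ⟨u, rfl⟩ := hw
    rw [subst_purePower, inner_purePower, inner_purePower, evalAt_subst, Matrix.transpose_transpose]
  | zero => simp
  | add w w' _ _ hw hw' => rw [inner_add_right, map_add, inner_add_right, hw, hw']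
  | smul c w _ hw => rw [inner_smul_right, map_smul, inner_smul_right, hw]

theorem norm_subst_of_mul_transpose {A : Matrix (Fin n) (Fin n) ℝ}
    (hA : A * A.transpose = 1) (v : SymTensor n p) : ‖subst A v‖ = ‖v‖ := by
  have h : inner ℝ (subst A v) (subst A v) = inner ℝ v v := by
    rw [inner_subst_left, subst_subst, hA, subst_one]
  rw [real_inner_self_eq_norm_sq, real_inner_self_eq_norm_sq] at h
  exact (pow_left_inj₀ (norm_nonneg _) (norm_nonneg _) two_ne_zero).1 h

theorem grad_subst (A : Matrix (Fin n) (Fin n) ℝ) (v : SymTensor n p) (u : Fin n → ℝ)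
    (i : Fin n) : grad i u (subst A v) = ∑ l, A l i * grad l (A.mulVec u) v := by
  have h1 := hasFDerivAt_evalAt (subst A v) u
  have h2 := (hasFDerivAt_evalAt v (A.mulVec u)).comp u
    (A.mulVecLin.toContinuousLinearMap.hasFDerivAt)
  have h3 : (fun u => evalAt u (subst A v)) =
      (fun u => evalAt u v) ∘ A.mulVecLin.toContinuousLinearMap := by
    funext x
    simp [evalAt_subst]
  rw [h3] at h1
  have h4 := congrArg (fun L : (Fin n → ℝ) →L[ℝ] ℝ => L (Pi.single i 1)) (h1.unique h2)
  simpa [Pi.single_apply, Matrix.mulVec_single_one, mul_comm]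
    using h4

end SymTensor

/-! ### Critical points of the distance function -/

namespace SymTensor

variable {n p : ℕ}

theorem purePower_smul (r : ℝ) (u : Fin n → ℝ) :
    purePower p (r • u) = r ^ p • purePower p u :=
  ext_evalAt fun x => by
    rw [map_smul, evalAt_purePower, evalAt_purePower, smul_dotProduct, smul_eq_mul, mul_pow,
      smul_eq_mul]

theorem purePower_ne_zero {u : Fin n → ℝ} (hu : u ≠ 0) : purePower p u ≠ 0 := by
  intro h
  have h1 := evalAt_purePower (p := p) u u
  rw [h, map_zero] at h1
  exact pow_ne_zero p (fun h2 => hu (dotProduct_self_eq_zero.1 h2)) h1.symm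

theorem purePower_zero (hp : 1 ≤ p) : purePower p (0 : Fin n → ℝ) = 0 :=
  ext_evalAt fun x => by
    rw [evalAt_purePower, zero_dotProduct, map_zero, zero_pow (by omega)]

theorem smul_purePower_mem_rankOne (hp : 1 ≤ p) {c : ℝ} (hc : c ≠ 0) {u : Fin n → ℝ}
    (hu : u ≠ 0) : c • purePower p u ∈ rankOne n p := by
  refine ⟨smul_ne_zero hc (purePower_ne_zero hu), (|c| ^ (p : ℝ)⁻¹) • u, ?_⟩
  rw [purePower_smul, Real.rpow_inv_natCast_pow (abs_nonneg c) (by omega)]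
  rcases abs_choice c with h | h <;> rw [h]
  · exact Or.inl rfl
  · exact Or.inr (by rw [neg_smul, neg_neg])

theorem mem_rankOne_iff (hp : 1 ≤ p) {x : SymTensor n p} :
    x ∈ rankOne n p ↔ ∃ c : ℝ, c ≠ 0 ∧ ∃ u : Fin n → ℝ, u ⬝ᵥ u = 1 ∧ x = c • purePower p u := by
  constructor
  · rintro ⟨hx, u, hu⟩
    have hu0 : u ≠ 0 := by
      rintro rfl
      rw [purePower_zero hp] at hu
      simp [hx] at hu
    have hpos : 0 < u ⬝ᵥ u :=
      lt_of_le_of_ne (Finset.sum_nonneg fun i _ => mul_self_nonneg (u i)) fun h => hu0 (dotProduct_self_eq_zero.1 h.symm)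
    set r := √(u ⬝ᵥ u) with hr
    have hr0 : r ≠ 0 := (Real.sqrt_pos.2 hpos).ne'
    have hru : u = r • (r⁻¹ • u) := by rw [smul_smul, mul_inv_cancel₀ hr0, one_smul]
    have hunit : (r⁻¹ • u) ⬝ᵥ (r⁻¹ • u) = 1 := by
      rw [smul_dotProduct, dotProduct_smul, ← Real.mul_self_sqrt hpos.le, ← hr]
      simp only [smul_eq_mul]
      field_simp
    rcases hu with hu | hu
    · refine ⟨r ^ p, pow_ne_zero _ hr0, r⁻¹ • u, hunit, ?_⟩
      rw [← purePower_smul, ← hru, hu]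
    · refine ⟨-r ^ p, neg_ne_zero.2 (pow_ne_zero _ hr0), r⁻¹ • u, hunit, ?_⟩
      rw [neg_smul, ← purePower_smul, ← hru, hu]
  · rintro ⟨c, hc, u, hu, rfl⟩
    refine smul_purePower_mem_rankOne hp hc ?_
    rintro rfl
    simp at hu

theorem hasDerivAt_sqDist_comp (v : SymTensor n p) {γ : ℝ → SymTensor n p} {γ' : SymTensor n p}
    (hγ : HasDerivAt γ γ' 0) :
    HasDerivAt (fun t => sqDist v (γ t)) (2 * inner ℝ (v - γ 0) (-γ')) 0 := by
  simpa [sqDist] using ((hasDerivAt_const (0 : ℝ) v).sub hγ).norm_sq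

theorem hasDerivAt_evalAt_comp (q : SymTensor n p) {B : ℝ → Fin n → ℝ} {B' : Fin n → ℝ}
    (hB : HasDerivAt B B' 0) :
    HasDerivAt (fun t => evalAt (B t) q) (∑ i, grad i (B 0) q * B' i) 0 := by
  have h := (hasFDerivAt_evalAt q (B 0)).comp_hasDerivAt (0 : ℝ) hB
  simp only [sum_apply, smul_apply, ContinuousLinearMap.proj_apply, smul_eq_mul] at h
  exact h

/-- The tangent space of the rank-one locus at `c u^p` is spanned by the tensors `u^(p-1) w`,
so that criticality at `c u^p` means that the gradient of the polynomial `v - c u^p` vanishes at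
`u`. -/
theorem isCriticalPointOn_smul_purePower_iff (hp : 1 ≤ p) (v : SymTensor n p) {c : ℝ} (hc : c ≠ 0)
    {u : Fin n → ℝ} (hu : u ≠ 0) :
    IsCriticalPointOn (sqDist v) (rankOne n p) (c • purePower p u) ↔
      ∀ i, grad i u (v - c • purePower p u) = 0 := by
  set q := v - c • purePower p u with hq
  constructor
  · rintro ⟨-, h⟩ i
    set γ : ℝ → SymTensor n p := fun t => c • purePower p (u + t • Pi.single i 1) with hγ
    have hline : ∀ t : ℝ, HasDerivAt (fun t : ℝ => u + t • (Pi.single i 1 : Fin n → ℝ))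
        (Pi.single i 1) t := fun t => by
      simpa using ((hasDerivAt_id t).smul_const (Pi.single i (1 : ℝ) : Fin n → ℝ)).const_add u
    have hcd : ContDiff ℝ ∞ γ := contDiff_of_evalAt fun y => by
      simp only [hγ, map_smul, evalAt_purePower, add_dotProduct, smul_dotProduct, smul_eq_mul]
      fun_prop
    have hγ0 : γ 0 = c • purePower p u := by simp [hγ]
    have hmem : ∀ᶠ t in nhds (0 : ℝ), γ t ∈ rankOne n p := by
      have hne : ∀ᶠ t in nhds (0 : ℝ), u + t • (Pi.single i 1 : Fin n → ℝ) ≠ 0 :=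
        (hline 0).continuousAt.eventually_ne (by simpa using hu)
      filter_upwards [hne] with t ht using smul_purePower_mem_rankOne hp hc ht
    have hd : HasDerivAt γ (deriv γ 0) 0 :=
      (hcd.differentiable (by simp) 0).hasDerivAt
    have h0 := (hasDerivAt_sqDist_comp v hd).unique (h γ hcd.contDiffAt hγ0 hmem)
    rw [hγ0, ← hq, inner_neg_right] at h0
    have h1 : HasDerivAt (fun t => inner ℝ q (γ t)) (inner ℝ q (deriv γ 0)) 0 := by
      simpa using (hasDerivAt_const (0 : ℝ) q).inner ℝ hd
    have h2 : (fun t => inner ℝ q (γ t)) =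
        fun t => c * evalAt (u + t • (Pi.single i 1 : Fin n → ℝ)) q := by
      funext t
      rw [hγ, inner_smul_right, inner_purePower]
    rw [h2] at h1
    have h3 := h1.unique ((hasDerivAt_evalAt_comp q (hline 0)).const_mul c)
    have h4 : inner ℝ q (deriv γ 0) = 0 := by linarith
    rw [h4] at h3
    have h5 := (mul_eq_zero.1 h3.symm).resolve_left hc
    simpa [Pi.single_apply] using h5
  · intro h
    refine ⟨smul_purePower_mem_rankOne hp hc hu, fun γ hγ hγ0 hmem => ?_⟩
    have hd : HasDerivAt γ (deriv γ 0) 0 :=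
      (hγ.differentiableAt (by simp)).hasDerivAt
    have hq0 : evalAt u q = 0 := by
      have := sum_mul_grad u q
      simp only [h, mul_zero, Finset.sum_const_zero] at this
      exact (mul_eq_zero.1 this.symm).resolve_left (by exact_mod_cast (by omega : p ≠ 0))
    -- For `γ t = e w^p`, the smooth functions `a` and `B` take the values `e (w ⬝ u)^p` and
    -- `e (w ⬝ u)^(p-1) w`, so that `a^(p-1) ⟪q, γ⟫ = q(B)`. Differentiating this identity avoids
    -- lifting `γ` to a smooth curve of vectors `w`.
    set a : ℝ → ℝ := fun t => evalAt u (γ t) with ha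
    set B : ℝ → Fin n → ℝ := fun t i => (p : ℝ)⁻¹ * grad i u (γ t) with hB
    have had : HasDerivAt a (evalAt u (deriv γ 0)) 0 :=
      (evalAt u : SymTensor n p →ₗ[ℝ] ℝ).toContinuousLinearMap.hasFDerivAt.comp_hasDerivAt 0 hd
    have hBd : HasDerivAt B (fun i => (p : ℝ)⁻¹ * grad i u (deriv γ 0)) 0 := by
      rw [hasDerivAt_pi]
      intro i
      exact ((grad i u : SymTensor n p →ₗ[ℝ] ℝ).toContinuousLinearMap.hasFDerivAt.comp_hasDerivAt
        0 hd).const_mul _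
    have hp0 : (p : ℝ) ≠ 0 := by exact_mod_cast (by omega : p ≠ 0)
    have hkey : (fun t => a t ^ (p - 1) * inner ℝ q (γ t)) =ᶠ[nhds 0]
        fun t => evalAt (B t) q := by
      filter_upwards [hmem] with t ht
      obtain ⟨e, -, w, -, hw⟩ := (mem_rankOne_iff hp).1 ht
      have hBt : B t = (e * (w ⬝ᵥ u) ^ (p - 1)) • w := by
        funext i
        simp only [hB, hw, map_smul, grad_purePower, smul_eq_mul, Pi.smul_apply]
        field_simp
      rw [hBt, evalAt_smul, ha]
      simp only [hw, map_smul, evalAt_purePower, inner_smul_right, inner_purePower, smul_eq_mul]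
      obtain ⟨k, rfl⟩ : ∃ k, p = k + 1 := ⟨p - 1, by omega⟩
      simp only [Nat.add_sub_cancel]
      ring
    have hB0 : B 0 = (c * (u ⬝ᵥ u) ^ (p - 1)) • u := by
      funext i
      simp only [hB, hγ0, map_smul, grad_purePower, smul_eq_mul, Pi.smul_apply]
      field_simp
    have h1 : HasDerivAt (fun t => inner ℝ q (γ t)) (inner ℝ q (deriv γ 0)) 0 := by
      simpa using (hasDerivAt_const (0 : ℝ) q).inner ℝ hd
    have h2 := ((had.pow (p - 1)).mul h1).unique
      ((hasDerivAt_evalAt_comp q hBd).congr_of_eventuallyEq hkey)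
    simp only [hB0, grad_smul, h, mul_zero, zero_mul, Finset.sum_const_zero] at h2
    simp only [hγ0, inner_smul_right, inner_purePower, hq0, mul_zero, zero_add] at h2
    have ha0 : a 0 ≠ 0 := by
      rw [ha]
      simp only [hγ0, map_smul, evalAt_purePower, smul_eq_mul]
      exact mul_ne_zero hc (pow_ne_zero _ fun h => hu (dotProduct_self_eq_zero.1 h))
    have h3 : inner ℝ q (deriv γ 0) = 0 := by
      simpa [ha0] using h2
    have h4 := hasDerivAt_sqDist_comp v hd
    rw [hγ0, ← hq, inner_neg_right, h3, neg_zero, mul_zero] at h4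
    exact h4

/-- The unit vectors at which the polynomial function `v` has a critical point on the sphere,
with nonzero critical value. -/
def critDirs (v : SymTensor n p) : Set (Fin n → ℝ) :=
  {u | u ⬝ᵥ u = 1 ∧ evalAt u v ≠ 0 ∧ ∃ l : ℝ, ∀ i, grad i u v = l * u i}

theorem grad_eq_of_mem_critDirs {v : SymTensor n p} {u : Fin n → ℝ} (hu : u ∈ critDirs v)
    (i : Fin n) : grad i u v = p * evalAt u v * u i := by
  obtain ⟨h1, -, l, hl⟩ := hu
  have h := sum_mul_grad u v
  have : ∑ i, u i * grad i u v = l := by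
    simp_rw [hl]
    calc ∑ i, u i * (l * u i) = l * (u ⬝ᵥ u) := by
          rw [dotProduct, Finset.mul_sum]
          exact Finset.sum_congr rfl fun i _ => by ring
      _ = l := by rw [h1, mul_one]
  rw [hl, ← h, this]

theorem neg_mem_critDirs {v : SymTensor n p} {u : Fin n → ℝ} (hu : u ∈ critDirs v) :
    -u ∈ critDirs v := by
  obtain ⟨h1, h2, l, hl⟩ := hu
  have hneg : -u = (-1 : ℝ) • u := by simp
  refine ⟨by simpa using h1, ?_, (-1) ^ (p - 1) * (-l), fun i => ?_⟩
  · rw [hneg, evalAt_smul]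
    exact mul_ne_zero (pow_ne_zero _ (by norm_num)) h2
  · rw [hneg, grad_smul, hl, Pi.smul_apply, smul_eq_mul]
    ring

theorem setOf_isCriticalPointOn_eq_image (hp : 1 ≤ p) (v : SymTensor n p) :
    {x | IsCriticalPointOn (sqDist v) (rankOne n p) x} =
      (fun u => evalAt u v • purePower p u) '' critDirs v := by
  have hne : ∀ {u : Fin n → ℝ}, u ⬝ᵥ u = 1 → u ≠ 0 := by
    rintro u hu rfl
    simp at hu
  ext x
  constructor
  · intro hx
    obtain ⟨c, hc, u, hu, rfl⟩ := (mem_rankOne_iff hp).1 hx.1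
    have h := (isCriticalPointOn_smul_purePower_iff hp v hc (hne hu)).1 hx
    have hg : ∀ i, grad i u v = p * c * u i := by
      intro i
      have := h i
      rw [map_sub, map_smul, grad_purePower, hu, one_pow, sub_eq_zero] at this
      rw [this, smul_eq_mul]
      ring
    have hE := sum_mul_grad u v
    have hE2 : ∑ i, u i * grad i u v = p * c := by
      calc ∑ i, u i * grad i u v = p * c * (u ⬝ᵥ u) := by
            rw [dotProduct, Finset.mul_sum]
            exact Finset.sum_congr rfl fun i _ => by rw [hg]; ring
        _ = p * c := by rw [hu, mul_one]
    have hcv : evalAt u v = c :=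
      mul_left_cancel₀ (by exact_mod_cast (by omega : p ≠ 0)) (hE.symm.trans hE2)
    exact ⟨u, ⟨hu, by rwa [hcv], _, hg⟩, by simp only [hcv]⟩
  · rintro ⟨u, hu, rfl⟩
    refine (isCriticalPointOn_smul_purePower_iff hp v hu.2.1 (hne hu.1)).2 fun i => ?_
    rw [map_sub, map_smul, grad_purePower, hu.1, one_pow, grad_eq_of_mem_critDirs hu, smul_eq_mul]
    ring

theorem eq_or_eq_neg_of_smul_purePower_eq (hp : 1 ≤ p) {c d : ℝ} (hd : d ≠ 0)
    {u w : Fin n → ℝ} (hu : u ⬝ᵥ u = 1) (hw : w ⬝ᵥ w = 1)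
    (h : c • purePower p u = d • purePower p w) : w = u ∨ w = -u := by
  have heval : ∀ x : Fin n → ℝ, c * (u ⬝ᵥ x) ^ p = d * (w ⬝ᵥ x) ^ p := fun x => by
    simpa [evalAt_purePower] using congrArg (evalAt x) h
  -- The component of `w` orthogonal to `u` vanishes.
  set s := u ⬝ᵥ w with hs
  have hwu : w ⬝ᵥ u = s := by rw [dotProduct_comm]
  have h1 : w ⬝ᵥ (w - s • u) = 0 := by
    have h2 := heval (w - s • u)
    have h3 : u ⬝ᵥ (w - s • u) = 0 := by
      rw [dotProduct_sub, dotProduct_smul, hu, smul_eq_mul, mul_one, ← hs, sub_self]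
    rw [h3, zero_pow (by omega), mul_zero] at h2
    exact pow_eq_zero_iff (by omega) |>.1 ((mul_eq_zero.1 h2.symm).resolve_left hd)
  rw [dotProduct_sub, dotProduct_smul, hw, hwu, smul_eq_mul, sub_eq_zero] at h1
  have h4 : (w - s • u) ⬝ᵥ (w - s • u) = 0 := by
    simp only [dotProduct_sub, sub_dotProduct, dotProduct_smul, smul_dotProduct, hu, hw, hwu,
      smul_eq_mul, ← hs]
    linarith
  have h5 : w = s • u := sub_eq_zero.1 (dotProduct_self_eq_zero.1 h4)
  rcases mul_self_eq_one_iff.1 h1.symm with h6 | h6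
  · exact Or.inl (by rw [h5, h6, one_smul])
  · exact Or.inr (by rw [h5, h6, neg_one_smul])

/-- Each critical tensor `c u^p` comes from exactly the two critical directions `u` and `-u`. -/
theorem encard_critDirs (hp : 1 ≤ p) (v : SymTensor n p) :
    ((critDirs v).encard : ℝ≥0∞) = 2 * criticalCount n p v := by
  set F : (Fin n → ℝ) → SymTensor n p := fun u => evalAt u v • purePower p u with hF
  set C := {x | IsCriticalPointOn (sqDist v) (rankOne n p) x} with hC
  have himg : C = F '' critDirs v := setOf_isCriticalPointOn_eq_image hp v
  have hex : ∀ x : C, ∃ u ∈ critDirs v, F u = x := fun x =>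
    himg.subset x.2
  -- A choice `s` of one direction for each critical point splits the directions into `s` and `-s`.
  choose s hs hsF using hex
  have hFneg : ∀ u, F (-u) = F u := by
    intro u
    have hneg : -u = (-1 : ℝ) • u := by simp
    rw [hF]
    simp only
    rw [hneg, evalAt_smul, purePower_smul, smul_smul, mul_right_comm, ← mul_pow]
    norm_num
  have hinj : Function.Injective s := fun x y hxy => Subtype.ext (by rw [← hsF x, ← hsF y, hxy])
  have hunion : critDirs v = Set.range s ∪ Set.range fun x => -s x := by
    ext u
    constructor
    · intro hu
      set x : C := ⟨F u, himg ▸ Set.mem_image_of_mem F hu⟩ with hx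
      have h := hsF x
      rcases eq_or_eq_neg_of_smul_purePower_eq hp hu.2.1 (hs x).1 hu.1 h with h | h
      · exact Or.inl ⟨x, h.symm⟩
      · exact Or.inr ⟨x, h.symm⟩
    · rintro (⟨x, rfl⟩ | ⟨x, rfl⟩)
      · exact hs x
      · exact neg_mem_critDirs (hs x)
  have hdisj : Disjoint (Set.range s) (Set.range fun x => -s x) := by
    rw [Set.disjoint_left]
    rintro _ ⟨x, rfl⟩ ⟨y, hy⟩
    have hxy : y = x := Subtype.ext (by
      rw [← hsF y, ← hsF x, ← hFneg (s y)]
      exact congrArg F hy)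
    subst hxy
    have h0 : s y = 0 := self_eq_neg.1 hy.symm
    have := (hs y).1
    rw [h0] at this
    simp at this
  have hcard : (critDirs v).encard = 2 * C.encard := by
    rw [hunion, Set.encard_union_eq hdisj, ← Set.image_univ, ← Set.image_univ,
      hinj.encard_image,
      Function.Injective.encard_image (f := fun x => -s x) (neg_injective.comp hinj) Set.univ,
      Set.encard_univ, two_mul]
    rfl
  rw [hcard, criticalCount]
  simp [hC]

/-- When the rank-one tensors fill the whole space up to the origin, the only critical point of
the distance to `v ≠ 0` is `v` itself. -/
theorem criticalCount_eq_one (h : rankOne n p = {0}ᶜ) {v : SymTensor n p} (hv : v ≠ 0) :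
    criticalCount n p v = 1 := by
  have : {x | IsCriticalPointOn (sqDist v) (rankOne n p) x} = {v} := by
    ext x
    simp only [Set.mem_ofPred_eq, Set.mem_singleton_iff]
    constructor
    · rintro ⟨hx, hcrit⟩
      have hx0 : x ≠ 0 := by simpa [h] using hx
      have hline : HasDerivAt (fun t : ℝ => x + t • (v - x)) (v - x) 0 := by
        simpa using ((hasDerivAt_id (0 : ℝ)).smul_const (v - x)).const_add x
      have hd := hcrit (fun t : ℝ => x + t • (v - x)) (by fun_prop) (by simp) (by
        rw [h]
        exact hline.continuousAt.eventually_ne (by simpa using hx0))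
      have h0 := (hasDerivAt_sqDist_comp v hline).unique hd
      have : inner ℝ (v - x) (v - x) = 0 := by
        rw [inner_neg_right] at h0
        simp only [zero_smul, add_zero] at h0
        linarith
      exact (sub_eq_zero.1 (inner_self_eq_zero.1 this)).symm
    · rintro rfl
      refine ⟨by simpa [h] using hv, fun γ hγ hγ0 _ => ?_⟩
      have hd : HasDerivAt γ (deriv γ 0) 0 := (hγ.differentiableAt (by simp)).hasDerivAt
      simpa [hγ0] using hasDerivAt_sqDist_comp x hd
  rw [criticalCount, this]
  simp

/-- A linear form is the first power of its gradient. -/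
theorem rankOne_eq_compl_zero_of_degree_one : rankOne n 1 = {0}ᶜ := by
  ext x
  refine ⟨fun hx => hx.1, fun hx => ⟨hx, fun i => grad i 0 x, Or.inl (ext_evalAt fun u => ?_)⟩⟩
  have h := sum_mul_grad u x
  have hg : ∀ i, grad i u x = grad i 0 x := fun i => by
    have h1 := grad_smul i 0 u x
    simpa using h1.symm
  rw [evalAt_purePower, pow_one, dotProduct]
  simp only [Nat.cast_one, one_mul] at h
  rw [← h]
  exact Finset.sum_congr rfl fun i _ => by rw [hg, mul_comm]

theorem rankOne_eq_compl_zero_of_dim_one (hp : 1 ≤ p) : rankOne 1 p = {0}ᶜ := by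
  ext x
  refine ⟨fun hx => hx.1, fun hx => ?_⟩
  have h1 : ∀ u : Fin 1 → ℝ, u = u 0 • (fun _ => 1) := fun u => by
    funext i
    fin_cases i
    simp
  have hx1 : x = evalAt (fun _ => 1) x • purePower p (fun _ => 1) := ext_evalAt fun u => by
    rw [h1 u, evalAt_smul, evalAt_smul, map_smul, evalAt_purePower]
    simp [dotProduct]
  have hne : evalAt (fun _ => 1) x ≠ 0 := fun h0 => hx (by rw [hx1, h0, zero_smul]; rfl)
  rw [hx1]
  exact smul_purePower_mem_rankOne hp hne fun h => one_ne_zero (congrFun h 0)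

end SymTensor

/-! ### Orthonormal coordinates -/

namespace SymTensor

section Coordinates

variable {n p : ℕ}

/-- The coordinate of a symmetric tensor along the normalized monomial with exponent `σ`. It
vanishes when `σ` does not have degree `p`. -/
noncomputable def coord (σ : Fin n →₀ ℕ) : SymTensor n p →ₗ[ℝ] ℝ :=
  √(monomialNormSq p σ) • (MvPolynomial.lcoeff ℝ σ ∘ₗ toPoly)

theorem coord_apply (σ : Fin n →₀ ℕ) (v : SymTensor n p) :
    coord σ v = √(monomialNormSq p σ) * (toPoly v).coeff σ := rfl

/-- The normalized monomial with exponent `σ`, or zero when `σ` does not have degree `p`. -/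
noncomputable def unitMonomial (σ : Fin n →₀ ℕ) : SymTensor n p :=
  ⟨MvPolynomial.homogeneousComponent p (MvPolynomial.monomial σ (√(monomialNormSq p σ))⁻¹),
    MvPolynomial.homogeneousComponent_mem _ _⟩

theorem coeff_unitMonomial {σ : Fin n →₀ ℕ} (τ : Fin n →₀ ℕ) :
    (toPoly (unitMonomial σ : SymTensor n p)).coeff τ =
      if τ.degree = p then if σ = τ then (√(monomialNormSq p σ))⁻¹ else 0 else 0 := by
  change (MvPolynomial.homogeneousComponent p (MvPolynomial.monomial σ _)).coeff τ = _
  rw [MvPolynomial.coeff_homogeneousComponent, MvPolynomial.coeff_monomial]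

theorem inner_unitMonomial (σ : Fin n →₀ ℕ) (v : SymTensor n p) :
    inner ℝ (unitMonomial σ) v = coord σ v := by
  rw [inner_def, bombieriInner, coord_apply]
  have hdeg : σ ∈ exponents n p ↔ σ.degree = p := by rw [mem_exponents, Finsupp.degree_eq_sum]
  by_cases h : σ.degree = p
  · rw [Finset.sum_eq_single_of_mem σ (hdeg.2 h), coeff_unitMonomial, if_pos h, if_pos rfl]
    · have h0 : √(monomialNormSq p σ) ≠ 0 := (Real.sqrt_pos.2 (monomialNormSq_pos p σ)).ne'
      nth_rewrite 1 [← Real.mul_self_sqrt (monomialNormSq_pos p σ).le]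
      field_simp
    · intro τ _ hne
      rw [coeff_unitMonomial, if_neg hne.symm, ite_self, zero_mul, mul_zero]
  · rw [(isHomogeneous_toPoly v).coeff_eq_zero h, mul_zero]
    refine Finset.sum_eq_zero fun τ hτ => ?_
    have hne : σ ≠ τ := by
      rintro rfl
      exact h (hdeg.1 hτ)
    rw [coeff_unitMonomial, if_neg hne, ite_self, zero_mul, mul_zero]

theorem coord_unitMonomial {σ : Fin n →₀ ℕ} (hσ : σ.degree = p) (τ : Fin n →₀ ℕ) :
    coord τ (unitMonomial σ : SymTensor n p) = if σ = τ then 1 else 0 := by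
  rw [coord_apply, coeff_unitMonomial]
  by_cases h : σ = τ
  · subst h
    rw [if_pos hσ, if_pos rfl, if_pos rfl, mul_inv_cancel₀
      (Real.sqrt_pos.2 (monomialNormSq_pos p σ)).ne']
  · rw [if_neg h, if_neg h, ite_self, mul_zero]

theorem orthonormal_unitMonomial {J : Type*} {σ : J → Fin n →₀ ℕ}
    (hσ : ∀ j, (σ j).degree = p) (hinj : Function.Injective σ) :
    Orthonormal ℝ fun j => (unitMonomial (σ j) : SymTensor n p) := by
  classical
  rw [orthonormal_iff_ite]
  intro i j
  rw [inner_unitMonomial, coord_unitMonomial (hσ j)]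
  simp only [hinj.eq_iff, eq_comm]

theorem measurable_coord (σ : Fin n →₀ ℕ) : Measurable (coord σ : SymTensor n p → ℝ) :=
  (coord σ : SymTensor n p →ₗ[ℝ] ℝ).continuous_of_finiteDimensional.measurable

theorem map_coord_stdGaussian {J : Type*} [Fintype J] {σ : J → Fin n →₀ ℕ}
    (hσ : ∀ j, (σ j).degree = p) (hinj : Function.Injective σ) :
    (stdGaussian (SymTensor n p)).map (fun v j => coord (σ j) v) =
      Measure.pi fun _ => gaussianReal 0 1 := by
  rw [← map_inner_stdGaussian_eq_pi (orthonormal_unitMonomial hσ hinj)]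
  simp_rw [inner_unitMonomial]

/-- Disjoint groups of orthonormal coordinates are independent. -/
theorem lintegral_coord_mul_coord {J L : Type*} [Fintype J] [Fintype L] {σ : J → Fin n →₀ ℕ}
    {τ : L → Fin n →₀ ℕ} (hσ : ∀ j, (σ j).degree = p) (hτ : ∀ j, (τ j).degree = p)
    (hinj : Function.Injective (Sum.elim σ τ)) {f : (J → ℝ) → ℝ≥0∞} {g : (L → ℝ) → ℝ≥0∞}
    (hf : Measurable f) (hg : Measurable g) :
    ∫⁻ v, f (fun j => coord (σ j) v) * g (fun l => coord (τ l) v) ∂stdGaussian (SymTensor n p) =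
      (∫⁻ y, f y ∂Measure.pi fun _ => gaussianReal 0 1) *
        ∫⁻ w, g w ∂Measure.pi fun _ => gaussianReal 0 1 := by
  have hdeg : ∀ j, (Sum.elim σ τ j).degree = p := by
    rintro (j | j)
    exacts [hσ j, hτ j]
  have hm : Measurable fun (v : SymTensor n p) j => coord (Sum.elim σ τ j) v :=
    measurable_pi_lambda _ fun j => measurable_coord _
  have hpres := measurePreserving_sumPiEquivProdPi
    (fun _ : J ⊕ L => gaussianReal 0 1)
  rw [← lintegral_prod_mul hf.aemeasurable hg.aemeasurable, ← hpres.map_eq,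
    lintegral_map (by fun_prop) (MeasurableEquiv.measurable _),
    ← map_coord_stdGaussian hdeg hinj,
    lintegral_map (by fun_prop) hm]
  rfl

end Coordinates

section NorthPole

variable {m p : ℕ}

/-- The base point `e₁` of the unit sphere. -/
noncomputable def pole (m : ℕ) : Fin (m + 1) → ℝ := Pi.single 0 1

/-- The exponent of `e₁^p`. -/
noncomputable def expPole (m p : ℕ) : Fin (m + 1) →₀ ℕ := Finsupp.single 0 p

/-- The exponent of `e₁^(p-1) eⱼ`, for `j ≥ 2`. -/
noncomputable def expGrad (p : ℕ) (j : Fin m) : Fin (m + 1) →₀ ℕ :=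
  Finsupp.single 0 (p - 1) + Finsupp.single j.succ 1

/-- The exponent of `e₁^(p-2) eᵢ eⱼ`, for `i, j ≥ 2`. -/
noncomputable def expHess (p : ℕ) (s : Sym2 (Fin m)) : Fin (m + 1) →₀ ℕ :=
  Finsupp.single 0 (p - 2) + Sym2.lift ⟨fun i j => Finsupp.single i.succ 1 + Finsupp.single j.succ 1,
    fun _ _ => add_comm _ _⟩ s

theorem expHess_mk (p : ℕ) (i j : Fin m) : expHess p s(i, j) =
    Finsupp.single 0 (p - 2) + (Finsupp.single i.succ 1 + Finsupp.single j.succ 1) := rfl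

theorem degree_expPole : (expPole m p).degree = p := by simp [expPole]

theorem degree_expGrad (hp : 1 ≤ p) (j : Fin m) : (expGrad p j).degree = p := by
  rw [expGrad, map_add, Finsupp.degree_single, Finsupp.degree_single]
  omega

theorem degree_expHess (hp : 2 ≤ p) (s : Sym2 (Fin m)) : (expHess p s).degree = p := by
  induction s with
  | _ i j =>
    rw [expHess_mk, map_add, map_add, Finsupp.degree_single, Finsupp.degree_single,
      Finsupp.degree_single]
    omega

theorem expPole_apply_zero : expPole m p 0 = p := by simp [expPole]

theorem expGrad_apply_zero (j : Fin m) : expGrad p j 0 = p - 1 := by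
  simp [expGrad, Fin.succ_ne_zero]

theorem expHess_apply_zero (s : Sym2 (Fin m)) : expHess p s 0 = p - 2 := by
  induction s with
  | _ i j => simp [expHess_mk, Fin.succ_ne_zero]

theorem expPole_apply_succ (l : Fin m) : expPole m p l.succ = 0 := by
  simp [expPole]

theorem expGrad_apply_succ (j l : Fin m) : expGrad p j l.succ = if j = l then 1 else 0 := by
  simp [expGrad, Finsupp.single_apply]

theorem expHess_apply_succ (i j l : Fin m) : expHess p s(i, j) l.succ =
    (if i = l then 1 else 0) + if j = l then 1 else 0 := by
  simp [expHess_mk, Finsupp.single_apply]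

theorem expGrad_injective : Function.Injective (expGrad p : Fin m → _) := by
  intro i j h
  have h1 := DFunLike.congr_fun h j.succ
  rw [expGrad_apply_succ, expGrad_apply_succ, if_pos rfl] at h1
  by_contra hne
  simp [hne] at h1

theorem expHess_injective : Function.Injective (expHess p : Sym2 (Fin m) → _) := by
  intro s t h
  induction s with
  | _ i j =>
  induction t with
  | _ k l =>
  have h1 : ∀ a, ((if i = a then 1 else 0) + if j = a then 1 else 0 : ℕ) =
      (if k = a then 1 else 0) + if l = a then 1 else 0 := fun a => by
    have := DFunLike.congr_fun h a.succ
    rwa [expHess_apply_succ, expHess_apply_succ] at this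
  have hi := h1 i
  have hj := h1 j
  have hk := h1 k
  rw [Sym2.eq_iff]
  clear h h1
  grind

theorem monomialNormSq_expPole : monomialNormSq p (expPole m p) = 1 := by
  rw [monomialNormSq, Fin.prod_univ_succ, expPole_apply_zero]
  simp only [expPole_apply_succ]
  simp [Nat.factorial_ne_zero]

theorem monomialNormSq_expGrad (hp : 1 ≤ p) (j : Fin m) :
    monomialNormSq p (expGrad p j) = (p : ℝ)⁻¹ := by
  obtain ⟨q, rfl⟩ : ∃ q, p = q + 1 := ⟨p - 1, by omega⟩
  rw [monomialNormSq, Fin.prod_univ_succ, expGrad_apply_zero]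
  have h : ∀ l : Fin m, ((expGrad (q + 1) j l.succ)! : ℝ) = 1 := fun l => by
    rw [expGrad_apply_succ]
    split_ifs <;> simp
  simp only [h, Finset.prod_const_one, mul_one, Nat.add_sub_cancel, Nat.factorial_succ]
  have := Nat.factorial_ne_zero q
  push_cast
  field_simp

theorem monomialNormSq_expHess (hp : 2 ≤ p) (i j : Fin m) :
    monomialNormSq p (expHess p s(i, j)) =
      (if i = j then 2 else 1) * ((p : ℝ) * ((p : ℝ) - 1))⁻¹ := by
  obtain ⟨q, rfl⟩ : ∃ q, p = q + 2 := ⟨p - 2, by omega⟩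
  rw [monomialNormSq, Fin.prod_univ_succ, expHess_apply_zero]
  have h : ∏ l : Fin m, ((expHess (q + 2) s(i, j) l.succ)! : ℝ) = if i = j then 2 else 1 := by
    split_ifs with hij
    · subst hij
      rw [Finset.prod_eq_single i]
      · simp [expHess_apply_succ]
      · intro l _ hl
        simp [expHess_apply_succ, hl.symm]
      · simp
    · refine Finset.prod_eq_one fun l _ => ?_
      rw [expHess_apply_succ]
      by_cases h1 : i = l <;> by_cases h2 : j = l <;> simp_all
  rw [h, Nat.add_sub_cancel, Nat.factorial_succ, Nat.factorial_succ]
  have h3 : ((q ! : ℕ) : ℝ) ≠ 0 := by exact_mod_cast Nat.factorial_ne_zero q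
  have h4 : (q : ℝ) + 1 ≠ 0 := by positivity
  have h5 : (q : ℝ) + 2 ≠ 0 := by positivity
  have h6 : (q : ℝ) + 2 - 1 = q + 1 := by ring
  push_cast
  rw [h6]
  field_simp
  ring

theorem evalAt_pole (v : SymTensor (m + 1) p) : evalAt (pole m) v = coord (expPole m p) v := by
  rw [evalAt_apply, pole, (isHomogeneous_toPoly v).eval_single_one, coord_apply,
    monomialNormSq_expPole, Real.sqrt_one, one_mul, expPole]

theorem grad_pole_succ (hp : 1 ≤ p) (j : Fin m) (v : SymTensor (m + 1) p) :
    grad j.succ (pole m) v = √p * coord (expGrad p j) v := by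
  rw [grad_apply, pole, (isHomogeneous_toPoly v).pderiv.eval_single_one,
    MvPolynomial.coeff_pderiv, coord_apply, monomialNormSq_expGrad hp, Real.sqrt_inv, ← mul_assoc,
    mul_inv_cancel₀ (by positivity), one_mul, ← expGrad]
  simp

theorem grad_pole_zero (v : SymTensor (m + 1) p) :
    grad 0 (pole m) v = p * coord (expPole m p) v := by
  rw [← evalAt_pole, ← sum_mul_grad, pole]
  simp [Pi.single_apply]

theorem hess_pole_succ (hp : 1 ≤ p) (i j : Fin m) (v : SymTensor (m + 1) p) :
    hess i.succ j.succ (pole m) v =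
      √p * √((p : ℝ) - 1) * ((if i = j then √2 else 1) * coord (expHess p s(i, j)) v) := by
  rcases hp.eq_or_lt with rfl | hp
  · have h : MvPolynomial.pderiv j.succ (toPoly v) =
        MvPolynomial.C ((MvPolynomial.pderiv j.succ (toPoly v)).coeff 0) :=
      MvPolynomial.totalDegree_eq_zero_iff_eq_C.1
        (Nat.le_zero.1 (isHomogeneous_toPoly v).pderiv.totalDegree_le)
    rw [hess_apply, h, MvPolynomial.pderiv_C]
    simp
  · have hp2 : (0 : ℝ) < (p : ℝ) - 1 := by
      have : (1 : ℝ) < p := by exact_mod_cast hp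
      linarith
    rw [hess_apply, pole, (isHomogeneous_toPoly v).pderiv.pderiv.eval_single_one,
      MvPolynomial.coeff_pderiv, MvPolynomial.coeff_pderiv, coord_apply,
      monomialNormSq_expHess hp, expHess_mk, show p - 1 - 1 = p - 2 by omega]
    have h1 : √(p : ℝ) ≠ 0 := by positivity
    have h2 : √((p : ℝ) - 1) ≠ 0 := (Real.sqrt_pos.2 hp2).ne'
    have h3 : √((if i = j then 2 else 1) * ((p : ℝ) * ((p : ℝ) - 1))⁻¹) =
        (if i = j then √2 else 1) * (√(p : ℝ) * √((p : ℝ) - 1))⁻¹ := by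
      rw [Real.sqrt_mul (by split_ifs <;> norm_num), Real.sqrt_inv,
        Real.sqrt_mul (Nat.cast_nonneg p)]
      split_ifs <;> simp
    rw [h3]
    have h4 : √(2 : ℝ) * √2 = 2 := Real.mul_self_sqrt (by norm_num)
    have h5 : (Finsupp.single (0 : Fin (m + 1)) (p - 2) + Finsupp.single i.succ 1 :
        Fin (m + 1) →₀ ℕ) j.succ = if i = j then 1 else 0 := by
      simp [Finsupp.single_apply]
    have h6 : (Finsupp.single (0 : Fin (m + 1)) (p - 2) : Fin (m + 1) →₀ ℕ) i.succ = 0 := by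
      simp
    rw [h5, h6]
    rw [add_assoc (Finsupp.single 0 (p - 2))]
    generalize (toPoly v).coeff _ = c
    split_ifs
    · push_cast
      field_simp
      linear_combination -c * h4
    · push_cast
      field_simp
      ring

end NorthPole

end SymTensor

/-! ### Reflections moving the base point over the sphere -/

namespace SymTensor

variable {m p : ℕ}

/-- The vector `(1, y)`. -/
def dirVec (y : Fin m → ℝ) : Fin (m + 1) → ℝ := Fin.cons 1 y

/-- The squared length of `(1, y)`. -/
def dirSq (y : Fin m → ℝ) : ℝ := 1 + ∑ i, y i ^ 2

/-- The reflection in the hyperplane orthogonal to `(1, y)`. The image of the base point runs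
over the sphere without the base point: this is a stereographic projection. -/
noncomputable def reflMat (y : Fin m → ℝ) : Matrix (Fin (m + 1)) (Fin (m + 1)) ℝ :=
  1 - (2 / dirSq y) • Matrix.vecMulVec (dirVec y) (dirVec y)

@[simp] theorem dirVec_zero (y : Fin m → ℝ) : dirVec y 0 = 1 := rfl

@[simp] theorem dirVec_succ (y : Fin m → ℝ) (i : Fin m) : dirVec y i.succ = y i := rfl

theorem dirSq_pos (y : Fin m → ℝ) : 0 < dirSq y := by unfold dirSq; positivity

theorem dirVec_dotProduct_self (y : Fin m → ℝ) : dirVec y ⬝ᵥ dirVec y = dirSq y := by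
  rw [dotProduct, Fin.sum_univ_succ, dirSq]
  simp [sq]

theorem reflMat_apply (y : Fin m → ℝ) (i j : Fin (m + 1)) :
    reflMat y i j = (if i = j then 1 else 0) - 2 / dirSq y * (dirVec y i * dirVec y j) := by
  simp [reflMat, Matrix.one_apply, Matrix.vecMulVec_apply]

theorem transpose_reflMat (y : Fin m → ℝ) : (reflMat y).transpose = reflMat y := by
  ext i j
  rw [Matrix.transpose_apply, reflMat_apply, reflMat_apply, mul_comm (dirVec y j)]
  simp only [eq_comm]

theorem reflMat_mulVec (y : Fin m → ℝ) (w : Fin (m + 1) → ℝ) :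
    (reflMat y).mulVec w = w - (2 / dirSq y * (dirVec y ⬝ᵥ w)) • dirVec y := by
  rw [reflMat, Matrix.sub_mulVec, Matrix.one_mulVec, Matrix.smul_mulVec, Matrix.vecMulVec_mulVec]
  ext i
  simp
  ring

theorem reflMat_mulVec_mulVec (y : Fin m → ℝ) (w : Fin (m + 1) → ℝ) :
    (reflMat y).mulVec ((reflMat y).mulVec w) = w := by
  have h := (dirSq_pos y).ne'
  rw [reflMat_mulVec, reflMat_mulVec, dotProduct_sub, dotProduct_smul, dirVec_dotProduct_self]
  ext i
  simp only [Pi.sub_apply, Pi.smul_apply, smul_eq_mul]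
  field_simp
  ring

theorem reflMat_mul_self (y : Fin m → ℝ) : reflMat y * reflMat y = 1 :=
  Matrix.ext_of_mulVec_single fun i => by
    rw [← Matrix.mulVec_mulVec, reflMat_mulVec_mulVec, Matrix.one_mulVec]

theorem reflMat_mulVec_pole (y : Fin m → ℝ) :
    (reflMat y).mulVec (pole m) = pole m - (2 / dirSq y) • dirVec y := by
  rw [reflMat_mulVec, pole, dotProduct_single, dirVec_zero, mul_one, mul_one]

theorem pole_dotProduct_self : pole m ⬝ᵥ pole m = 1 := by simp [pole]

theorem reflMat_mulVec_dotProduct (y : Fin m → ℝ) (u w : Fin (m + 1) → ℝ) :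
    (reflMat y).mulVec u ⬝ᵥ w = u ⬝ᵥ (reflMat y).mulVec w := by
  rw [Matrix.dotProduct_mulVec, ← Matrix.mulVec_transpose, transpose_reflMat]

theorem reflMat_mulVec_pole_injective :
    Function.Injective fun y : Fin m → ℝ => (reflMat y).mulVec (pole m) := by
  intro y z h
  simp only [reflMat_mulVec_pole, sub_right_inj] at h
  have h0 : 2 / dirSq y = 2 / dirSq z := by simpa using congrFun h 0
  have hy : 2 / dirSq y ≠ 0 := div_ne_zero two_ne_zero (dirSq_pos y).ne'
  funext i
  have h1 := congrFun h i.succ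
  rw [← h0] at h1
  exact mul_left_cancel₀ hy (by simpa using h1)

theorem range_reflMat_mulVec_pole {u : Fin (m + 1) → ℝ} (hu : u ⬝ᵥ u = 1) (hne : u ≠ pole m) :
    ∃ y : Fin m → ℝ, (reflMat y).mulVec (pole m) = u := by
  have hsum : u 0 ^ 2 + ∑ i : Fin m, u i.succ ^ 2 = 1 := by
    rw [← hu, dotProduct, Fin.sum_univ_succ]
    simp [sq]
  have h0 : 1 - u 0 ≠ 0 := by
    intro h
    apply hne
    have h1 : u 0 = 1 := by linarith
    rw [h1, one_pow, add_eq_left, Finset.sum_eq_zero_iff_of_nonneg fun i _ => sq_nonneg _] at hsum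
    funext i
    refine Fin.cases ?_ (fun i => ?_) i
    · simp [pole, h1]
    · simp [pole, pow_eq_zero_iff two_ne_zero |>.1 (hsum i (Finset.mem_univ i))]
  refine ⟨fun i => -u i.succ / (1 - u 0), ?_⟩
  have hA : dirSq (fun i : Fin m => -u i.succ / (1 - u 0)) = 2 / (1 - u 0) := by
    rw [dirSq]
    simp only [div_pow, neg_sq]
    rw [← Finset.sum_div, show ∑ i : Fin m, u i.succ ^ 2 = 1 - u 0 ^ 2 by linarith]
    field_simp
    ring
  rw [reflMat_mulVec_pole, hA]
  funext i
  refine Fin.cases ?_ (fun i => ?_) i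
  · simp [pole]
  · simp [pole]
    field_simp

theorem reflMat_mulVec_pole_ne (y : Fin m → ℝ) : (reflMat y).mulVec (pole m) ≠ pole m := by
  intro h
  have := congrFun h 0
  rw [reflMat_mulVec_pole] at this
  simp [(dirSq_pos y).ne'] at this

theorem contDiff_reflMat (i j : Fin (m + 1)) {k : WithTop ℕ∞} :
    ContDiff ℝ k fun y : Fin m → ℝ => reflMat y i j := by
  have hdir : ∀ i, ContDiff ℝ k fun y : Fin m → ℝ => dirVec y i := by
    intro i
    refine Fin.cases contDiff_const (fun i => ?_) i
    exact contDiff_apply ℝ ℝ i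
  have hsq : ContDiff ℝ k fun y : Fin m → ℝ => dirSq y := by
    unfold dirSq
    fun_prop
  simp only [reflMat_apply]
  exact contDiff_const.sub ((contDiff_const.div hsq fun y => (dirSq_pos y).ne').mul
    ((hdir i).mul (hdir j)))

/-- The derivative at `y`, in the direction of the `j`-th coordinate, of the orthogonal matrix
`reflMat · * reflMat y`. It is skew-symmetric, as the reflections are orthogonal. -/
theorem hasDerivAt_reflMat_mul (y : Fin m → ℝ) (j : Fin m) (l i : Fin (m + 1)) :
    HasDerivAt (fun t : ℝ => (reflMat (y + t • Pi.single j 1) * reflMat y :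
      Matrix (Fin (m + 1)) (Fin (m + 1)) ℝ) l i)
      (2 / dirSq y * (dirVec y i * (if l = j.succ then 1 else 0) -
        dirVec y l * (if i = j.succ then 1 else 0))) 0 := by
  have hA := (dirSq_pos y).ne'
  set w : Fin (m + 1) → ℝ := (reflMat y).mulVec (Pi.single i 1) with hw
  have haw : dirVec y ⬝ᵥ w = -dirVec y i := by
    rw [hw, reflMat_mulVec, dotProduct_sub, dotProduct_smul, dirVec_dotProduct_self,
      dotProduct_single, smul_eq_mul]
    field_simp
    ring
  have hwj : w j.succ = (if i = j.succ then 1 else 0) - 2 / dirSq y * (dirVec y i * y j) := by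
    rw [hw, reflMat_mulVec, dotProduct_single]
    simp [Pi.single_apply, eq_comm]
    ring
  have hdir : ∀ (t : ℝ) (q : Fin (m + 1)), dirVec (y + t • Pi.single j 1) q =
      dirVec y q + t * (if q = j.succ then 1 else 0) := by
    intro t q
    refine Fin.cases ?_ (fun q => ?_) q
    · simp [(Fin.succ_ne_zero j).symm]
    · simp [Pi.single_apply]
  have hdot : ∀ t : ℝ, dirVec (y + t • Pi.single j 1) ⬝ᵥ w = -dirVec y i + t * w j.succ := by
    intro t
    rw [← haw]
    simp only [dotProduct, hdir, add_mul, Finset.sum_add_distrib]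
    simp
  have hsq : ∀ t : ℝ, dirSq (y + t • Pi.single j 1) = dirSq y + 2 * t * y j + t ^ 2 := by
    intro t
    simp only [← dirVec_dotProduct_self, dotProduct, hdir, add_mul, mul_add,
      Finset.sum_add_distrib]
    simp
    ring
  have hfun : (fun t : ℝ => (reflMat (y + t • Pi.single j 1) * reflMat y :
      Matrix (Fin (m + 1)) (Fin (m + 1)) ℝ) l i) =
      fun t => w l - 2 / (dirSq y + 2 * t * y j + t ^ 2) * (-dirVec y i + t * w j.succ) *
        (dirVec y l + t * (if l = j.succ then 1 else 0)) := by
    funext t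
    have h1 : (reflMat (y + t • Pi.single j 1) * reflMat y :
      Matrix (Fin (m + 1)) (Fin (m + 1)) ℝ) l i =
        (reflMat (y + t • Pi.single j 1)).mulVec w l := by
      rw [hw, Matrix.mulVec_mulVec, Matrix.mulVec_single_one]
      rfl
    rw [h1, reflMat_mulVec, hdot, hsq, Pi.sub_apply, Pi.smul_apply, hdir, smul_eq_mul]
  rw [hfun]
  have hden : HasDerivAt (fun t : ℝ => dirSq y + 2 * t * y j + t ^ 2) (2 * y j) 0 := by
    have h := (((hasDerivAt_id (0 : ℝ)).const_mul 2).mul_const (y j)).const_add (dirSq y)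
    simpa using h.fun_add ((hasDerivAt_id (0 : ℝ)).fun_pow 2)
  have h2 : HasDerivAt (fun t : ℝ => 2 / (dirSq y + 2 * t * y j + t ^ 2))
      (-(2 * (2 * y j)) / dirSq y ^ 2) 0 := by
    simpa using (hasDerivAt_const (0 : ℝ) (2 : ℝ)).fun_div hden (by simpa using hA)
  have h3 : HasDerivAt (fun t : ℝ => -dirVec y i + t * w j.succ) (w j.succ) 0 := by
    simpa using ((hasDerivAt_id (0 : ℝ)).mul_const (w j.succ)).const_add (-dirVec y i)
  have h4 : HasDerivAt (fun t : ℝ => dirVec y l + t * (if l = j.succ then 1 else 0))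
      (if l = j.succ then 1 else 0) 0 := by
    simpa using ((hasDerivAt_id (0 : ℝ)).mul_const
      (if l = j.succ then (1 : ℝ) else 0)).const_add (dirVec y l)
  have h5 := ((h2.fun_mul h3).fun_mul h4).const_sub (w l)
  convert! h5 using 1
  rw [hwj]
  simp only [mul_zero, zero_mul, add_zero, zero_pow two_ne_zero]
  generalize (if l = j.succ then (1 : ℝ) else 0) = d
  generalize (if i = j.succ then (1 : ℝ) else 0) = e
  field_simp
  ring

end SymTensor

/-! ### The parametrization of the incidence variety -/

/-- An endomorphism that fixes the kernel of a surjection `k` pointwise has the determinant of the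
endomorphism it induces on the target of `k`. -/
theorem LinearMap.det_eq_det_of_fixes_ker {K V U : Type*} [Field K] [AddCommGroup V] [Module K V]
    [FiniteDimensional K V] [AddCommGroup U] [Module K U] {k : V →ₗ[K] U}
    (hk : Function.Surjective k) {T : V →ₗ[K] V} {N : U →ₗ[K] U}
    (hT : ∀ x, k x = 0 → T x = x) (hN : ∀ x, k (T x) = N (k x)) :
    LinearMap.det T = LinearMap.det N := by
  have hle : LinearMap.ker k ≤ (LinearMap.ker k).comap T := fun x hx => by
    rw [LinearMap.mem_ker] at hx
    rw [Submodule.mem_comap, hT x hx, LinearMap.mem_ker, hx]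
  rw [LinearMap.det_eq_det_mul_det (LinearMap.ker k) T hle]
  have h1 : T.restrict hle = LinearMap.id := by
    ext x
    exact hT x x.2
  rw [h1, LinearMap.det_id, one_mul]
  set e := k.quotKerEquivOfSurjective hk with he
  have h2 : N = e.toLinearMap ∘ₗ (LinearMap.ker k).mapQ _ T hle ∘ₗ e.symm.toLinearMap := by
    refine LinearMap.ext fun u => ?_
    obtain ⟨x, rfl⟩ := hk u
    have : e.symm (k x) = (LinearMap.ker k).mkQ x := by
      rw [LinearEquiv.symm_apply_eq]
      rfl
    rw [LinearMap.comp_apply, LinearMap.comp_apply, LinearEquiv.coe_coe, LinearEquiv.coe_coe, this,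
      ← hN]
    rfl
  rw [h2, LinearMap.det_conj]

namespace SymTensor

variable {m p : ℕ}

/-- The coordinates along the unit tensors `√p e₁^(p-1) eⱼ`, `j ≥ 2`, which form an orthonormal
basis of the directions tangent to the unit rank-one tensors at `e₁^p`. -/
noncomputable def gradCoord : SymTensor (m + 1) p →ₗ[ℝ] (Fin m → ℝ) :=
  LinearMap.pi fun j => coord (expGrad p j)

/-- The projection onto the orthogonal complement of the tangent directions at `e₁^p`. -/
noncomputable def normalPart : SymTensor (m + 1) p →ₗ[ℝ] SymTensor (m + 1) p :=
  LinearMap.id - ∑ j, (coord (expGrad p j)).smulRight (unitMonomial (expGrad p j))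

/-- The tangent coordinates `y` of `x` choose a point of the sphere, and the reflection
`reflMat y` carries the normal part of `x` to a tensor with a critical point there. -/
noncomputable def param (x : SymTensor (m + 1) p) : SymTensor (m + 1) p :=
  subst (reflMat (gradCoord x)) (normalPart x)

theorem gradCoord_apply (x : SymTensor (m + 1) p) (j : Fin m) :
    gradCoord x j = coord (expGrad p j) x := rfl

theorem normalPart_apply (x : SymTensor (m + 1) p) :
    normalPart x = x - ∑ j, gradCoord x j • unitMonomial (expGrad p j) := by
  simp [normalPart, gradCoord_apply]

theorem gradCoord_unitMonomial (hp : 1 ≤ p) (i : Fin m) :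
    gradCoord (unitMonomial (expGrad p i) : SymTensor (m + 1) p) = Pi.single i 1 := by
  funext j
  rw [gradCoord_apply, coord_unitMonomial (degree_expGrad hp i), Pi.single_apply]
  simp only [expGrad_injective.eq_iff, eq_comm]

theorem gradCoord_sum (hp : 1 ≤ p) (y : Fin m → ℝ) :
    gradCoord (∑ j, y j • unitMonomial (expGrad p j) : SymTensor (m + 1) p) = y := by
  simp only [map_sum, map_smul, gradCoord_unitMonomial hp]
  exact (pi_eq_sum_univ' y).symm

theorem gradCoord_normalPart (hp : 1 ≤ p) (x : SymTensor (m + 1) p) :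
    gradCoord (normalPart x) = 0 := by
  rw [normalPart_apply, map_sub, gradCoord_sum hp, sub_self]

theorem normalPart_of_gradCoord_eq_zero {x : SymTensor (m + 1) p} (hx : gradCoord x = 0) :
    normalPart x = x := by
  simp [normalPart_apply, hx]

theorem normalPart_unitMonomial (hp : 1 ≤ p) (i : Fin m) :
    normalPart (unitMonomial (expGrad p i) : SymTensor (m + 1) p) = 0 := by
  rw [normalPart_apply, gradCoord_unitMonomial hp]
  simp [Pi.single_apply]

theorem gradCoord_surjective (hp : 1 ≤ p) :
    Function.Surjective (gradCoord : SymTensor (m + 1) p → Fin m → ℝ) :=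
  fun y => ⟨_, gradCoord_sum hp y⟩

theorem coord_normalPart (hp : 1 ≤ p) {τ : Fin (m + 1) →₀ ℕ} (hτ : ∀ j, expGrad p j ≠ τ)
    (x : SymTensor (m + 1) p) : coord τ (normalPart x) = coord τ x := by
  rw [normalPart_apply, map_sub, map_sum, Finset.sum_eq_zero, sub_zero]
  intro j _
  rw [map_smul, coord_unitMonomial (degree_expGrad hp j), if_neg (hτ j), smul_zero]

theorem norm_sq_eq_normalPart (hp : 1 ≤ p) (x : SymTensor (m + 1) p) :
    ‖x‖ ^ 2 = ‖normalPart x‖ ^ 2 + ∑ j, gradCoord x j ^ 2 := by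
  have hx : x = normalPart x + ∑ j, gradCoord x j • unitMonomial (expGrad p j) := by
    rw [normalPart_apply, sub_add_cancel]
  have horth : inner ℝ (normalPart x)
      (∑ j, gradCoord x j • unitMonomial (expGrad p j) : SymTensor (m + 1) p) = 0 := by
    rw [inner_sum]
    refine Finset.sum_eq_zero fun j _ => ?_
    rw [inner_smul_right, real_inner_comm, inner_unitMonomial, ← gradCoord_apply,
      gradCoord_normalPart hp, Pi.zero_apply, mul_zero]
  have hon := orthonormal_unitMonomial (p := p) (fun j : Fin m => degree_expGrad hp j)
    expGrad_injective
  have hs : ‖(∑ j, gradCoord x j • unitMonomial (expGrad p j) : SymTensor (m + 1) p)‖ ^ 2 =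
      ∑ j, gradCoord x j ^ 2 := by
    rw [← real_inner_self_eq_norm_sq, hon.inner_sum]
    simp [sq]
  conv_lhs => rw [hx]
  rw [norm_add_sq_real, horth, hs]
  ring

/-- As the reflections act by isometries, the Gaussian density at `param x` does not involve the
tangent coordinates of `x`. -/
theorem norm_param (x : SymTensor (m + 1) p) : ‖param x‖ = ‖normalPart x‖ :=
  norm_subst_of_mul_transpose (by rw [transpose_reflMat, reflMat_mul_self]) _

theorem subst_reflMat_subst (y : Fin m → ℝ) (v : SymTensor (m + 1) p) :
    subst (reflMat y) (subst (reflMat y) v) = v := by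
  rw [subst_subst, reflMat_mul_self, subst_one]

theorem abs_det_subst_reflMat (y : Fin m → ℝ) :
    |LinearMap.det (subst (reflMat y) : SymTensor (m + 1) p →ₗ[ℝ] SymTensor (m + 1) p)| = 1 := by
  have h : (subst (reflMat y) : SymTensor (m + 1) p →ₗ[ℝ] SymTensor (m + 1) p) *
      subst (reflMat y) = 1 :=
    LinearMap.ext fun v => subst_reflMat_subst y v
  have h2 := congrArg LinearMap.det h
  rw [map_mul, map_one] at h2
  rcases mul_self_eq_one_iff.1 h2 with h3 | h3 <;> rw [h3] <;> simp

theorem contDiff_evalAt_comp {n : ℕ} {F : Type*} [NormedAddCommGroup F] [NormedSpace ℝ F]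
    {f : F → SymTensor n p} {w : F → Fin n → ℝ} {k : WithTop ℕ∞} (hf : ContDiff ℝ k f)
    (hw : ContDiff ℝ k w) : ContDiff ℝ k fun x => evalAt (w x) (f x) := by
  set b := stdOrthonormalBasis ℝ (SymTensor n p)
  have h : (fun x => evalAt (w x) (f x)) =
      fun x => ∑ i, inner ℝ (b i) (f x) * MvPolynomial.eval (w x) (toPoly (b i)) := by
    funext x
    conv_lhs => rw [← b.sum_repr' (f x)]
    simp only [map_sum, map_smul, smul_eq_mul, evalAt_apply]
  rw [h]
  exact ContDiff.sum fun i _ => (contDiff_const.inner ℝ hf).mul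
    ((MvPolynomial.contDiff_eval _).comp hw)

theorem contDiff_param {k : WithTop ℕ∞} :
    ContDiff ℝ k (param : SymTensor (m + 1) p → SymTensor (m + 1) p) := by
  refine contDiff_of_evalAt fun u => ?_
  simp only [param, evalAt_subst]
  refine contDiff_evalAt_comp
    (normalPart : SymTensor (m + 1) p →ₗ[ℝ] _).toContinuousLinearMap.contDiff ?_
  have hg : ContDiff ℝ k (gradCoord : SymTensor (m + 1) p → Fin m → ℝ) :=
    (gradCoord : SymTensor (m + 1) p →ₗ[ℝ] _).toContinuousLinearMap.contDiff
  rw [contDiff_pi]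
  intro i
  simp only [Matrix.mulVec, dotProduct]
  exact ContDiff.sum fun j _ => ((contDiff_reflMat i j).comp hg).mul contDiff_const

theorem hasDerivAt_param_line (x ζ : SymTensor (m + 1) p) :
    HasDerivAt (fun t : ℝ => param (x + t • ζ)) (fderiv ℝ param x ζ) 0 := by
  have hline : HasDerivAt (fun t : ℝ => x + t • ζ) ζ 0 := by
    simpa using ((hasDerivAt_id (0 : ℝ)).smul_const ζ).const_add x
  have h : HasFDerivAt param (fderiv ℝ param x) (x + (0 : ℝ) • ζ) := by
    rw [zero_smul, add_zero]
    exact (contDiff_param.differentiable one_ne_zero x).hasFDerivAt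
  exact h.comp_hasDerivAt (0 : ℝ) hline

theorem fderiv_param_of_gradCoord_eq_zero (x : SymTensor (m + 1) p) {ζ : SymTensor (m + 1) p}
    (hζ : gradCoord ζ = 0) :
    fderiv ℝ param x ζ = subst (reflMat (gradCoord x)) ζ := by
  have h := hasDerivAt_param_line x ζ
  have hfun : (fun t : ℝ => param (x + t • ζ)) =
      fun t => param x + t • subst (reflMat (gradCoord x)) ζ := by
    funext t
    simp only [param, map_add, map_smul, hζ, smul_zero, add_zero,
      normalPart_of_gradCoord_eq_zero hζ]
  rw [hfun] at h
  refine h.unique ?_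
  simpa using ((hasDerivAt_id (0 : ℝ)).smul_const
    (subst (reflMat (gradCoord x)) ζ)).const_add (param x)

/-- The matrix `√p w₀ I - √(p-1) C(w₁)` formed from the coordinates of a tensor at the
base point. -/
noncomputable def hessMat (x : SymTensor (m + 1) p) : Matrix (Fin m) (Fin m) ℝ :=
  (√(p : ℝ) * coord (expPole m p) x) • (1 : Matrix (Fin m) (Fin m) ℝ)
    - √((p : ℝ) - 1) • symGaussianMatrix m fun s => coord (expHess p s) x

theorem expGrad_ne_expPole (hp : 1 ≤ p) (j : Fin m) : expGrad p j ≠ expPole m p := by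
  intro h
  have := DFunLike.congr_fun h 0
  rw [expGrad_apply_zero, expPole_apply_zero] at this
  omega

theorem expGrad_ne_expHess (hp : 2 ≤ p) (j : Fin m) (s : Sym2 (Fin m)) :
    expGrad p j ≠ expHess p s := by
  intro h
  have := DFunLike.congr_fun h 0
  rw [expGrad_apply_zero, expHess_apply_zero] at this
  omega

theorem hessMat_normalPart (hp : 1 ≤ p) (x : SymTensor (m + 1) p) :
    hessMat (normalPart x) = hessMat x := by
  rw [hessMat, hessMat, coord_normalPart hp (fun j => expGrad_ne_expPole hp j)]
  rcases hp.eq_or_lt with rfl | hp'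
  · simp
  · simp only [coord_normalPart hp (fun j => expGrad_ne_expHess hp' j _)]

/-- The tangent coordinates of the derivative of `param` in a tangent direction. Along such a line
the normal part `z` is constant, so the reflected curve is `z ∘ M t` with `M t` orthogonal and
`M 0 = 1`. The derivative of its gradient at the base point has a term from the Hessian of `z` and
one from the gradient of `z`, which is radial. -/
theorem gradCoord_subst_fderiv_param (hp : 1 ≤ p) (x : SymTensor (m + 1) p) (i j : Fin m) :
    gradCoord (subst (reflMat (gradCoord x))
        (fderiv ℝ param x (unitMonomial (expGrad p j)))) i =
      -(2 / dirSq (gradCoord x)) * hessMat x i j := by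
  set y := gradCoord x with hy
  set z := normalPart x with hz
  set E : SymTensor (m + 1) p := unitMonomial (expGrad p j) with hE
  set M : ℝ → Matrix (Fin (m + 1)) (Fin (m + 1)) ℝ :=
    fun t => reflMat (y + t • Pi.single j 1) * reflMat y with hM
  have hp0 : (0 : ℝ) < p := by exact_mod_cast hp
  have hsqrt : √(p : ℝ) ≠ 0 := (Real.sqrt_pos.2 hp0).ne'
  have hpath : ∀ t : ℝ, subst (reflMat y) (param (x + t • E)) = subst (M t) z := by
    intro t
    rw [param, map_add, map_smul, map_add, map_smul, hE, gradCoord_unitMonomial hp,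
      normalPart_unitMonomial hp, smul_zero, add_zero, subst_subst]
  set L : SymTensor (m + 1) p →ₗ[ℝ] ℝ := coord (expGrad p i) ∘ₗ subst (reflMat y) with hL
  have h1 : HasDerivAt (fun t : ℝ => √(p : ℝ) * L (param (x + t • E)))
      (√(p : ℝ) * L (fderiv ℝ param x E)) 0 :=
    (L.toContinuousLinearMap.hasFDerivAt.comp_hasDerivAt (0 : ℝ)
      (hasDerivAt_param_line x E)).const_mul _
  have hfun : (fun t : ℝ => √(p : ℝ) * L (param (x + t • E))) =
      fun t => ∑ l, M t l i.succ * grad l ((M t).mulVec (pole m)) z := by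
    funext t
    rw [hL, LinearMap.comp_apply, hpath, ← grad_pole_succ hp, grad_subst]
  have hMd : ∀ l q, HasDerivAt (fun t => M t l q)
      (2 / dirSq y * (dirVec y q * (if l = j.succ then 1 else 0) -
        dirVec y l * (if q = j.succ then 1 else 0))) 0 := fun l q =>
    hasDerivAt_reflMat_mul y j l q
  have hMpole : ∀ t, (M t).mulVec (pole m) = fun l => M t l 0 := by
    intro t
    rw [pole, Matrix.mulVec_single_one]
    rfl
  have hpd : HasDerivAt (fun t => (M t).mulVec (pole m))
      (fun l => 2 / dirSq y * (if l = j.succ then 1 else 0)) 0 := by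
    simp only [hMpole]
    rw [hasDerivAt_pi]
    intro l
    have := hMd l 0
    simpa [(Fin.succ_ne_zero j).symm] using this
  have hM0 : M 0 = 1 := by rw [hM]; simp [reflMat_mul_self]
  have hg : ∀ l, HasDerivAt (fun t => grad l ((M t).mulVec (pole m)) z)
      (2 / dirSq y * hess j.succ l (pole m) z) 0 := by
    intro l
    have h := (hasFDerivAt_grad z l ((M 0).mulVec (pole m))).comp_hasDerivAt (0 : ℝ) hpd
    rw [hM0, Matrix.one_mulVec] at h
    have hval : (∑ q, hess q l (pole m) z •
        (ContinuousLinearMap.proj q : (Fin (m + 1) → ℝ) →L[ℝ] ℝ))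
          (fun l => 2 / dirSq y * (if l = j.succ then 1 else 0)) =
        2 / dirSq y * hess j.succ l (pole m) z := by
      simp [mul_comm]
    rw [hval] at h
    exact h
  have h2 : HasDerivAt (fun t => ∑ l, M t l i.succ * grad l ((M t).mulVec (pole m)) z)
      (∑ l, (2 / dirSq y * (dirVec y i.succ * (if l = j.succ then 1 else 0) -
        dirVec y l * (if i.succ = j.succ then 1 else 0)) * grad l ((M 0).mulVec (pole m)) z +
        M 0 l i.succ * (2 / dirSq y * hess j.succ l (pole m) z))) 0 :=
    HasDerivAt.fun_sum fun l _ => (hMd l i.succ).fun_mul (hg l)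
  rw [hfun] at h1
  have h3 := h1.unique h2
  -- The gradient of the normal part at the base point is radial.
  have hgz : ∀ l : Fin m, grad l.succ (pole m) z = 0 := fun l => by
    rw [grad_pole_succ hp, ← gradCoord_apply, hz, gradCoord_normalPart hp, Pi.zero_apply, mul_zero]
  rw [hM0, Matrix.one_mulVec, Finset.sum_add_distrib, Fin.sum_univ_succ] at h3
  simp only [hgz, mul_zero, Finset.sum_const_zero, add_zero, grad_pole_zero, dirVec_zero,
    (Fin.succ_ne_zero j).symm, if_false, zero_sub, one_mul, Fin.succ_inj, Matrix.one_apply,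
    ite_mul, zero_mul, Finset.sum_ite_eq', Finset.mem_univ, if_true, hess_pole_succ hp] at h3
  change L (fderiv ℝ param x E) = _
  rw [← hessMat_normalPart hp, ← hz]
  refine mul_left_cancel₀ hsqrt (h3.trans ?_)
  have hpp : √(p : ℝ) * √(p : ℝ) = p := Real.mul_self_sqrt hp0.le
  simp only [hessMat, symGaussianMatrix, Matrix.sub_apply, Matrix.smul_apply, Matrix.one_apply,
    Matrix.of_apply, smul_eq_mul]
  rw [Sym2.eq_swap (a := j)]
  by_cases hij : i = j
  · subst hij
    simp only [if_true]
    linear_combination (2 / dirSq y * coord (expPole m p) z) * hpp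
  · simp only [if_neg hij, if_neg (Ne.symm hij)]
    ring

/-- The Jacobian of the parametrization. After composition with the reflection, the derivative is the
identity on normal directions, so only its tangent block matters. -/
theorem abs_det_fderiv_param (hp : 1 ≤ p) (x : SymTensor (m + 1) p) :
    |(fderiv ℝ param x).det| = (2 / dirSq (gradCoord x)) ^ m * |(hessMat x).det| := by
  set R : SymTensor (m + 1) p →ₗ[ℝ] SymTensor (m + 1) p := subst (reflMat (gradCoord x)) with hR
  set T : SymTensor (m + 1) p →ₗ[ℝ] SymTensor (m + 1) p :=
    R * (fderiv ℝ param x).toLinearMap with hT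
  have hdetT : |LinearMap.det T| = |(fderiv ℝ param x).det| := by
    rw [hT, map_mul, abs_mul, hR, abs_det_subst_reflMat, one_mul]
  have hfix : ∀ ζ, gradCoord ζ = 0 → T ζ = ζ := fun ζ hζ => by
    change R (fderiv ℝ param x ζ) = ζ
    rw [fderiv_param_of_gradCoord_eq_zero x hζ, hR, subst_reflMat_subst]
  set N := Matrix.toLin' (-(2 / dirSq (gradCoord x)) • hessMat x) with hN
  have hcomm : ∀ ζ, gradCoord (T ζ) = N (gradCoord ζ) := by
    intro ζ
    have hζ : ζ = normalPart ζ + ∑ j, gradCoord ζ j • unitMonomial (expGrad p j) := by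
      rw [normalPart_apply, sub_add_cancel]
    conv_lhs => rw [hζ]
    rw [map_add, hfix _ (gradCoord_normalPart hp ζ), map_add, gradCoord_normalPart hp, zero_add]
    funext i
    rw [hN, Matrix.toLin'_apply]
    simp only [map_sum, map_smul, Finset.sum_apply, Pi.smul_apply, Matrix.mulVec, dotProduct,
      Matrix.smul_apply]
    refine Finset.sum_congr rfl fun j _ => ?_
    have := gradCoord_subst_fderiv_param hp x i j
    rw [smul_eq_mul, smul_eq_mul, ← this, mul_comm]
    rfl
  have hpos : 0 ≤ 2 / dirSq (gradCoord x) := (div_pos two_pos (dirSq_pos _)).le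
  rw [← hdetT, LinearMap.det_eq_det_of_fixes_ker (gradCoord_surjective hp) hfix hcomm, hN,
    LinearMap.det_toLin', Matrix.det_smul, abs_mul, abs_pow, abs_neg, abs_of_nonneg hpos,
    Fintype.card_fin]

/-- The preimages of `v` under the parametrization, with nonzero value at the base point, are in
bijection with the critical directions of `v` other than the base point. -/
theorem encard_param_preimage (hp : 1 ≤ p) (v : SymTensor (m + 1) p) :
    ({x | coord (expPole m p) x ≠ 0} ∩ param ⁻¹' {v}).encard =
      (critDirs v \ {pole m}).encard := by
  set S := {x : SymTensor (m + 1) p | coord (expPole m p) x ≠ 0} ∩ param ⁻¹' {v} with hS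
  have hsub : ∀ {x}, param x = v → normalPart x = subst (reflMat (gradCoord x)) v := by
    rintro x rfl
    rw [param, subst_reflMat_subst]
  have hinj : Set.InjOn (fun x => (reflMat (gradCoord x)).mulVec (pole m)) S := by
    intro x hx x' hx' h
    have hy : gradCoord x = gradCoord x' := reflMat_mulVec_pole_injective h
    have hz : normalPart x = normalPart x' := by rw [hsub hx.2, hsub hx'.2, hy]
    rw [normalPart_apply, normalPart_apply, hy] at hz
    exact sub_left_injective hz
  rw [← hinj.encard_image]
  congr 1
  ext u
  constructor
  · rintro ⟨x, hx, rfl⟩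
    have hz := hsub hx.2
    set y := gradCoord x
    refine ⟨⟨?_, ?_, ?_⟩, reflMat_mulVec_pole_ne y⟩
    · rw [reflMat_mulVec_dotProduct, reflMat_mulVec_mulVec, pole_dotProduct_self]
    · rw [← evalAt_subst, ← hz, evalAt_pole, coord_normalPart hp fun j => expGrad_ne_expPole hp j]
      exact hx.1
    · refine ⟨p * coord (expPole m p) x, fun i => ?_⟩
      have hv : v = subst (reflMat y) (normalPart x) := by rw [hz, subst_reflMat_subst]
      rw [hv, grad_subst, reflMat_mulVec_mulVec, Fin.sum_univ_succ, grad_pole_zero,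
        coord_normalPart hp fun j => expGrad_ne_expPole hp j]
      have h0 : ∀ l : Fin m, grad l.succ (pole m) (normalPart x) = 0 := fun l => by
        rw [grad_pole_succ hp, ← gradCoord_apply, gradCoord_normalPart hp, Pi.zero_apply, mul_zero]
      simp only [h0, mul_zero, Finset.sum_const_zero, add_zero]
      rw [pole, Matrix.mulVec_single_one, mul_comm, Matrix.col_apply]
      conv_lhs => rw [← transpose_reflMat, Matrix.transpose_apply]
  · rintro ⟨⟨hu, hne, l, hl⟩, hpole⟩
    obtain ⟨y, rfl⟩ := range_reflMat_mulVec_pole hu hpole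
    set z := subst (reflMat y) v with hz
    have hgz : gradCoord z = 0 := by
      funext i
      have hp0 : √(p : ℝ) ≠ 0 := (Real.sqrt_pos.2 (by exact_mod_cast hp)).ne'
      refine mul_left_cancel₀ hp0 ?_
      rw [gradCoord_apply, ← grad_pole_succ hp, hz, grad_subst, Pi.zero_apply, mul_zero]
      simp only [hl]
      calc ∑ q, reflMat y q i.succ * (l * (reflMat y).mulVec (pole m) q)
          = l * ((reflMat y).transpose.mulVec ((reflMat y).mulVec (pole m)) i.succ) := by
            simp only [Matrix.mulVec, dotProduct, Matrix.transpose_apply, Finset.mul_sum]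
            exact Finset.sum_congr rfl fun q _ => Finset.sum_congr rfl fun _ _ => by ring
        _ = 0 := by
            rw [transpose_reflMat, reflMat_mulVec_mulVec, pole,
              Pi.single_eq_of_ne (Fin.succ_ne_zero i), mul_zero]
    set x : SymTensor (m + 1) p := z + ∑ j, y j • unitMonomial (expGrad p j) with hx
    have hgx : gradCoord x = y := by rw [hx, map_add, hgz, zero_add, gradCoord_sum hp]
    have hnx : normalPart x = z := by rw [normalPart_apply, hgx, hx, add_sub_cancel_right]
    refine ⟨x, ⟨?_, ?_⟩, by simp only [hgx]⟩
    · rw [Set.mem_ofPred_eq, ← coord_normalPart hp fun j => expGrad_ne_expPole hp j, hnx,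
        ← evalAt_pole, hz, evalAt_subst]
      exact hne
    · rw [Set.mem_preimage, Set.mem_singleton_iff, param, hnx, hgx, hz, subst_reflMat_subst]

end SymTensor

/-! ### Integration over the incidence variety -/

namespace SymTensor

variable {m p : ℕ}

/-- The density, relative to the standard Gaussian measure on `ℝ^m`, of a multiple of the uniform
measure of the sphere in the stereographic chart. -/
noncomputable def chartWeight (y : Fin m → ℝ) : ℝ :=
  (2 / dirSq y) ^ m * Real.exp ((∑ j, y j ^ 2) / 2)

theorem measurable_chartWeight : Measurable (chartWeight : (Fin m → ℝ) → ℝ) := by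
  unfold chartWeight dirSq
  fun_prop

theorem volume_coord_eq_zero {n : ℕ} {σ : Fin n →₀ ℕ} (hσ : σ.degree = p) :
    (volume : Measure (SymTensor n p)) {x | coord σ x = 0} = 0 := by
  refine Measure.addHaar_submodule volume (LinearMap.ker (coord σ)) fun h => ?_
  have : (unitMonomial σ : SymTensor n p) ∈ LinearMap.ker (coord σ) := by
    rw [h]
    trivial
  rw [LinearMap.mem_ker, coord_unitMonomial hσ, if_pos rfl] at this
  exact one_ne_zero this

theorem lintegral_stdGaussian {V : Type*} [NormedAddCommGroup V] [InnerProductSpace ℝ V]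
    [FiniteDimensional ℝ V] [MeasurableSpace V] [BorelSpace V] (f : V → ℝ≥0∞) :
    ∫⁻ v, f v ∂stdGaussian V =
      ∫⁻ v, ENNReal.ofReal (gaussianDensity V v) * f v ∂(volume : Measure V) := by
  rw [stdGaussian_eq_withDensity, lintegral_withDensity_eq_lintegral_mul_non_measurable _
    measurable_gaussianDensity.ennreal_ofReal (by simp)]
  rfl

theorem stdGaussian_absolutelyContinuous {V : Type*} [NormedAddCommGroup V]
    [InnerProductSpace ℝ V] [FiniteDimensional ℝ V] [MeasurableSpace V] [BorelSpace V] :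
    stdGaussian V ≪ (volume : Measure V) := by
  rw [stdGaussian_eq_withDensity]
  exact withDensity_absolutelyContinuous _ _

theorem gaussianDensity_param (hp : 1 ≤ p) (x : SymTensor (m + 1) p) :
    gaussianDensity _ (param x) =
      gaussianDensity _ x * Real.exp ((∑ j, gradCoord x j ^ 2) / 2) := by
  rw [gaussianDensity, gaussianDensity, norm_param, norm_sq_eq_normalPart hp x, mul_assoc,
    ← Real.exp_add]
  congr 2
  ring

theorem lintegral_encard_critDirs_diff_pole (hp : 1 ≤ p) :
    AEMeasurable (fun v : SymTensor (m + 1) p => ((critDirs v \ {pole m}).encard : ℝ≥0∞))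
      (stdGaussian (SymTensor (m + 1) p)) ∧
    ∫⁻ v : SymTensor (m + 1) p, ((critDirs v \ {pole m}).encard : ℝ≥0∞) ∂stdGaussian _ =
      ∫⁻ x : SymTensor (m + 1) p, ENNReal.ofReal (chartWeight (gradCoord x)) *
        ENNReal.ofReal |(hessMat x).det| ∂stdGaussian _ := by
  simp only [← encard_param_preimage hp]
  have hs : MeasurableSet {x : SymTensor (m + 1) p | coord (expPole m p) x ≠ 0} :=
    (measurable_coord _ (measurableSet_singleton (0 : ℝ))).compl
  obtain ⟨h1, h2⟩ := lintegral_encard_preimage_mul (volume : Measure (SymTensor (m + 1) p))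
    contDiff_param hs (measurable_gaussianDensity (V := SymTensor (m + 1) p)).ennreal_ofReal
  refine ⟨h1.mono_ac stdGaussian_absolutelyContinuous, ?_⟩
  rw [lintegral_stdGaussian, lintegral_stdGaussian]
  simp_rw [mul_comm (ENNReal.ofReal (gaussianDensity _ _)) ((_ : ℕ∞) : ℝ≥0∞)]
  rw [h2]
  have hae : ∀ᵐ x ∂(volume : Measure (SymTensor (m + 1) p)),
      x ∈ {x : SymTensor (m + 1) p | coord (expPole m p) x ≠ 0} := by
    rw [ae_iff]
    simpa using volume_coord_eq_zero (degree_expPole (m := m) (p := p))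
  rw [Measure.restrict_eq_self_of_ae_mem hae]
  refine lintegral_congr fun x => ?_
  rw [abs_det_fderiv_param hp, gaussianDensity_param hp,
    ENNReal.ofReal_mul (pow_nonneg (div_pos two_pos (dirSq_pos _)).le m),
    ENNReal.ofReal_mul (gaussianDensity_nonneg _), chartWeight,
    ENNReal.ofReal_mul (pow_nonneg (div_pos two_pos (dirSq_pos _)).le m)]
  ring

/-- For `m ≥ 1` the tensors with a critical point at the base point lie in a proper subspace. -/
theorem ae_pole_notMem_critDirs (hm : 1 ≤ m) (hp : 1 ≤ p) :
    ∀ᵐ v ∂stdGaussian (SymTensor (m + 1) p), pole m ∉ critDirs v := by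
  refine stdGaussian_absolutelyContinuous.ae_le (ae_iff.2 (measure_mono_null ?_
    (volume_coord_eq_zero (degree_expGrad hp (⟨0, hm⟩ : Fin m)))))
  intro v hv
  simp only [not_not, Set.mem_ofPred_eq] at hv
  have h := grad_eq_of_mem_critDirs hv (⟨0, hm⟩ : Fin m).succ
  have hsqrt : √(p : ℝ) ≠ 0 := (Real.sqrt_pos.2 (by exact_mod_cast hp)).ne'
  rw [grad_pole_succ hp, pole, Pi.single_eq_of_ne (Fin.succ_ne_zero _), mul_zero] at h
  exact (mul_eq_zero.1 h).resolve_left hsqrt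

/-- Twice the expected number of critical points, as a Gaussian integral over the parameters. -/
theorem lintegral_criticalCount (hm : 1 ≤ m) (hp : 1 ≤ p) :
    AEMeasurable (criticalCount (m + 1) p) (stdGaussian (SymTensor (m + 1) p)) ∧
    2 * ∫⁻ v, criticalCount (m + 1) p v ∂stdGaussian (SymTensor (m + 1) p) =
      ∫⁻ x : SymTensor (m + 1) p, ENNReal.ofReal (chartWeight (gradCoord x)) *
        ENNReal.ofReal |(hessMat x).det| ∂stdGaussian _ := by
  obtain ⟨h1, h2⟩ := lintegral_encard_critDirs_diff_pole (m := m) hp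
  have hae : (fun v : SymTensor (m + 1) p => ((critDirs v \ {pole m}).encard : ℝ≥0∞))
      =ᵐ[stdGaussian _] fun v => 2 * criticalCount (m + 1) p v := by
    filter_upwards [ae_pole_notMem_critDirs hm hp] with v hv
    rw [Set.sdiff_singleton_eq_self hv, encard_critDirs hp]
  have h3 : AEMeasurable (fun v => 2⁻¹ * (2 * criticalCount (m + 1) p v))
      (stdGaussian (SymTensor (m + 1) p)) := (h1.congr hae).const_mul _
  simp only [← mul_assoc, ENNReal.inv_mul_cancel two_ne_zero ENNReal.ofNat_ne_top, one_mul] at h3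
  refine ⟨h3, ?_⟩
  rw [← h2, lintegral_congr_ae hae, lintegral_const_mul'' _ h3]

end SymTensor

theorem measurable_absDet (m p : ℕ) : Measurable (absDet m p) := by
  have h : Continuous (absDet m p) := by
    unfold absDet symGaussianMatrix
    refine Continuous.abs (Continuous.matrix_det ?_)
    refine continuous_pi fun i => continuous_pi fun j => ?_
    simp only [Matrix.sub_apply, Matrix.smul_apply, Matrix.of_apply, smul_eq_mul]
    split_ifs <;> fun_prop
  exact h.measurable

namespace SymTensor

variable {m p : ℕ}

theorem lintegral_chartWeight_mul_hessMat (hp : 2 ≤ p) :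
    ∫⁻ x : SymTensor (m + 1) p, ENNReal.ofReal (chartWeight (gradCoord x)) *
        ENNReal.ofReal |(hessMat x).det| ∂stdGaussian _ =
      (∫⁻ y : Fin m → ℝ, ENNReal.ofReal (chartWeight y) ∂Measure.pi fun _ => gaussianReal 0 1) *
        ∫⁻ w, ENNReal.ofReal (absDet m p w) ∂gaussianCoords m := by
  have hp1 : 1 ≤ p := by omega
  have hinj : Function.Injective (Sum.elim (expGrad p : Fin m → _)
      (Sum.elim (fun _ : Unit => expPole m p) (expHess p))) := by
    refine expGrad_injective.sumElim
      ((Function.injective_of_subsingleton _).sumElim expHess_injective ?_) ?_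
    · intro _ s h
      have := DFunLike.congr_fun h 0
      rw [expPole_apply_zero, expHess_apply_zero] at this
      omega
    · rintro j (_ | s)
      · exact expGrad_ne_expPole hp1 j
      · exact expGrad_ne_expHess hp j s
  have hdeg : ∀ l : Unit ⊕ Sym2 (Fin m),
      (Sum.elim (fun _ : Unit => expPole m p) (expHess p) l).degree = p := by
    rintro (_ | s)
    · exact degree_expPole
    · exact degree_expHess hp s
  have hg : Measurable fun w : Unit ⊕ Sym2 (Fin m) → ℝ =>
      ENNReal.ofReal (absDet m p (w (Sum.inl ()), fun s => w (Sum.inr s))) :=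
    ((measurable_absDet m p).comp (by fun_prop)).ennreal_ofReal
  have h := lintegral_coord_mul_coord (p := p) (fun j => degree_expGrad hp1 j) hdeg hinj
    (measurable_chartWeight (m := m)).ennreal_ofReal hg
  refine Eq.trans ?_ (h.trans ?_)
  · rfl
  · congr 1
    have h1 := measurePreserving_sumPiEquivProdPi
      (fun _ : Unit ⊕ Sym2 (Fin m) => gaussianReal 0 1)
    have h2 := (measurePreserving_funUnique (gaussianReal 0 1) Unit).prod
      (MeasurePreserving.id (Measure.pi fun _ : Sym2 (Fin m) => gaussianReal 0 1))
    have h3 := h2.comp h1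
    rw [gaussianCoords, ← h3.map_eq, lintegral_map (measurable_absDet m p).ennreal_ofReal
      h3.measurable]
    rfl

/-- For `p = 1` the Hessian coordinates do not exist, and `w₀` alone enters the determinant. -/
theorem lintegral_chartWeight_mul_hessMat_one :
    ∫⁻ x : SymTensor (m + 1) 1, ENNReal.ofReal (chartWeight (gradCoord x)) *
        ENNReal.ofReal |(hessMat x).det| ∂stdGaussian _ =
      (∫⁻ y : Fin m → ℝ, ENNReal.ofReal (chartWeight y) ∂Measure.pi fun _ => gaussianReal 0 1) *
        ∫⁻ t, ENNReal.ofReal (|t| ^ m) ∂gaussianReal 0 1 := by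
  have hinj : Function.Injective (Sum.elim (expGrad 1 : Fin m → _)
      (fun _ : Unit => expPole m 1)) :=
    expGrad_injective.sumElim (Function.injective_of_subsingleton _)
      fun j _ => expGrad_ne_expPole le_rfl j
  have h := lintegral_coord_mul_coord (p := 1) (fun j => degree_expGrad le_rfl j)
    (fun _ => degree_expPole) hinj (measurable_chartWeight (m := m)).ennreal_ofReal
    (g := fun w => ENNReal.ofReal (|w ()| ^ m)) (by fun_prop)
  refine Eq.trans ?_ (h.trans ?_)
  · refine lintegral_congr fun x => ?_
    simp [hessMat, Matrix.smul_one_eq_diagonal]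
    rfl
  · congr 1
    have h1 := measurePreserving_funUnique (gaussianReal 0 1) Unit
    exact h1.lintegral_comp (f := fun t => ENNReal.ofReal (|t| ^ m)) (by fun_prop)

end SymTensor

/-! ### Gaussian moments -/

theorem integrable_abs_pow_gaussianReal (m : ℕ) :
    Integrable (fun t : ℝ => |t| ^ m) (gaussianReal 0 1) := by
  have h : MemLp id (m : ℝ≥0∞) (gaussianReal 0 1) := memLp_id_gaussianReal' _ (by simp)
  simpa using h.integrable_norm_pow'

/-- The absolute moments of a standard normal variable. -/
theorem integral_abs_pow_gaussianReal (m : ℕ) :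
    ∫ t, |t| ^ m ∂gaussianReal 0 1 =
      (2 : ℝ) ^ ((m : ℝ) / 2) * Real.Gamma (((m : ℝ) + 1) / 2) / √Real.pi := by
  rw [integral_gaussianReal_eq_integral_smul one_ne_zero]
  have h1 : ∀ t : ℝ, gaussianPDFReal 0 1 t • |t| ^ m =
      (fun r : ℝ => (√(2 * Real.pi))⁻¹ * (r ^ (m : ℝ) * Real.exp (-(1 / 2) * r ^ (2 : ℝ)))) |t| := by
    intro t
    simp only [gaussianPDFReal, smul_eq_mul, Real.rpow_natCast, Real.rpow_two, sq_abs,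
      NNReal.coe_one, mul_one, sub_zero]
    rw [show -t ^ 2 / 2 = -(1 / 2) * t ^ 2 by ring]
    ring
  simp_rw [h1]
  rw [integral_comp_abs (f := fun r : ℝ => (√(2 * Real.pi))⁻¹ *
    (r ^ (m : ℝ) * Real.exp (-(1 / 2) * r ^ (2 : ℝ)))), integral_const_mul,
    integral_rpow_mul_exp_neg_mul_rpow two_pos (by
      have : (0 : ℝ) ≤ m := Nat.cast_nonneg m
      linarith) (by norm_num)]
  have h2 : ((1 : ℝ) / 2) ^ (-((m : ℝ) + 1) / 2) = 2 ^ ((m : ℝ) / 2) * √2 := by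
    rw [one_div, Real.inv_rpow two_pos.le, ← Real.rpow_neg two_pos.le, Real.sqrt_eq_rpow,
      ← Real.rpow_add two_pos]
    congr 1
    ring
  rw [h2, Real.sqrt_mul two_pos.le]
  have h3 : √(2 : ℝ) ≠ 0 := by positivity
  have h4 : √Real.pi ≠ 0 := by positivity
  field_simp

/-- The random variable `f` has finite absolute moments of all orders. Such variables are closed
under sums and products, so that polynomials in standard normal variables are integrable. -/
def HasAllMoments {Ω : Type*} [MeasurableSpace Ω] (μ : Measure Ω) (f : Ω → ℝ) : Prop :=
  ∀ q : ℝ≥0∞, q ≠ ⊤ → MemLp f q μ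

namespace HasAllMoments

variable {Ω : Type*} [MeasurableSpace Ω] {μ : Measure Ω}

theorem const [IsFiniteMeasure μ] (c : ℝ) : HasAllMoments μ fun _ => c :=
  fun _ _ => memLp_const c

theorem sum {ι : Type*} {s : Finset ι} {f : ι → Ω → ℝ} (h : ∀ i ∈ s, HasAllMoments μ (f i)) :
    HasAllMoments μ fun w => ∑ i ∈ s, f i w :=
  fun q hq => memLp_finsetSum s fun i hi => h i hi q hq

theorem sub {f g : Ω → ℝ} (hf : HasAllMoments μ f) (hg : HasAllMoments μ g) :
    HasAllMoments μ fun w => f w - g w :=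
  fun q hq => (hf q hq).sub (hg q hq)

theorem mul {f g : Ω → ℝ} (hf : HasAllMoments μ f) (hg : HasAllMoments μ g) :
    HasAllMoments μ fun w => f w * g w := by
  intro q hq
  have : ENNReal.HolderTriple (2 * q) (2 * q) q := by
    refine ⟨?_⟩
    rw [ENNReal.mul_inv (a := 2) (Or.inl two_ne_zero) (Or.inl ENNReal.ofNat_ne_top), ← add_mul,
      ENNReal.inv_two_add_inv_two, one_mul]
  have h2q : 2 * q ≠ ⊤ := ENNReal.mul_ne_top ENNReal.ofNat_ne_top hq
  exact (hg (2 * q) h2q).mul (hf (2 * q) h2q)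

theorem prod [IsFiniteMeasure μ] {ι : Type*} {s : Finset ι} {f : ι → Ω → ℝ}
    (h : ∀ i ∈ s, HasAllMoments μ (f i)) : HasAllMoments μ fun w => ∏ i ∈ s, f i w := by
  classical
  induction s using Finset.induction_on with
  | empty => simpa using const 1
  | insert a s ha ih =>
    simp only [Finset.prod_insert ha]
    exact (h a (Finset.mem_insert_self a s)).mul
      (ih fun i hi => h i (Finset.mem_insert_of_mem hi))

theorem of_measurePreserving {X : Ω → ℝ} (hX : MeasurePreserving X μ (gaussianReal 0 1)) :
    HasAllMoments μ X :=
  fun q hq => (memLp_id_gaussianReal' q hq).comp_measurePreserving hX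

end HasAllMoments

instance (m : ℕ) : IsProbabilityMeasure (gaussianCoords m) := by
  unfold gaussianCoords
  infer_instance

theorem integrable_absDet (m p : ℕ) : Integrable (absDet m p) (gaussianCoords m) := by
  have h0 : HasAllMoments (gaussianCoords m) fun w => w.1 :=
    HasAllMoments.of_measurePreserving measurePreserving_fst
  have hs : ∀ s, HasAllMoments (gaussianCoords m) fun w => w.2 s := fun s =>
    HasAllMoments.of_measurePreserving
      ((measurePreserving_eval (fun _ : Sym2 (Fin m) => gaussianReal 0 1) s).comp
        measurePreserving_snd)
  have hdet : HasAllMoments (gaussianCoords m) fun w =>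
      ((√(p : ℝ) * w.1) • (1 : Matrix (Fin m) (Fin m) ℝ)
        - √((p : ℝ) - 1) • symGaussianMatrix m w.2).det := by
    simp only [Matrix.det_apply', Matrix.sub_apply, Matrix.smul_apply, smul_eq_mul]
    refine HasAllMoments.sum fun σ _ => (HasAllMoments.const _).mul
      (HasAllMoments.prod fun i _ => HasAllMoments.sub ?_ ?_)
    · exact ((HasAllMoments.const _).mul h0).mul (HasAllMoments.const _)
    · refine (HasAllMoments.const _).mul ?_
      simp only [symGaussianMatrix, Matrix.of_apply]
      split_ifs
      · exact (HasAllMoments.const _).mul (hs _)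
      · exact hs _
  exact (memLp_one_iff_integrable.1 (hdet 1 ENNReal.one_ne_top)).abs

theorem integral_absDet_one (m : ℕ) :
    ∫ w, absDet m 1 w ∂gaussianCoords m = ∫ t, |t| ^ m ∂gaussianReal 0 1 := by
  have h : ∀ w, absDet m 1 w = |w.1| ^ m := fun w => by
    simp [absDet, Matrix.smul_one_eq_diagonal]
  simp_rw [h]
  have hfst : MeasurePreserving Prod.fst (gaussianCoords m) (gaussianReal 0 1) :=
    measurePreserving_fst
  rw [← hfst.map_eq, integral_map hfst.measurable.aemeasurable (by fun_prop)]

/-! ### The expected number of critical points -/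

open SymTensor in
theorem criticalCount_ae_eq_one {n p : ℕ} (hn : 1 ≤ n) (h : rankOne n p = {0}ᶜ) :
    criticalCount n p =ᵐ[stdGaussian (SymTensor n p)] fun _ => 1 := by
  obtain ⟨m, rfl⟩ : ∃ m, n = m + 1 := ⟨n - 1, by omega⟩
  have hae : ∀ᵐ v ∂stdGaussian (SymTensor (m + 1) p), v ≠ 0 := by
    refine stdGaussian_absolutelyContinuous.ae_le (ae_iff.2 (measure_mono_null ?_
      (volume_coord_eq_zero (degree_expPole (m := m) (p := p)))))
    intro v hv
    simp only [ne_eq, not_not, Set.mem_ofPred_eq] at hv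
    simp [hv]
  filter_upwards [hae] with v hv using criticalCount_eq_one h hv

open SymTensor in
/-- The case of linear forms, where there is exactly one critical point, determines the integral
of the chart weight. -/
theorem lintegral_chartWeight_mul {m : ℕ} (hm : 1 ≤ m) :
    (∫⁻ y : Fin m → ℝ, ENNReal.ofReal (chartWeight y) ∂Measure.pi fun _ => gaussianReal 0 1) *
      ENNReal.ofReal (∫ t, |t| ^ m ∂gaussianReal 0 1) = 2 := by
  rw [ofReal_integral_eq_lintegral_ofReal (integrable_abs_pow_gaussianReal m)
    (ae_of_all _ fun t => by positivity), ← lintegral_chartWeight_mul_hessMat_one,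
    ← (lintegral_criticalCount hm le_rfl).2,
    lintegral_congr_ae (criticalCount_ae_eq_one (by omega) rankOne_eq_compl_zero_of_degree_one)]
  simp

open SymTensor in
theorem mainTheorem3 (n p : ℕ) (hn : 1 ≤ n) (hp : 1 ≤ p) :
    Integrable (absDet (n - 1) p) (gaussianCoords (n - 1)) ∧
    AEMeasurable (criticalCount n p) (stdGaussian (SymTensor n p)) ∧
    ∫⁻ v, criticalCount n p v ∂(stdGaussian (SymTensor n p)) =
      ENNReal.ofReal
        (√Real.pi / ((2 : ℝ) ^ (((n : ℝ) - 1) / 2) * Real.Gamma ((n : ℝ) / 2)) *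
          ∫ w, absDet (n - 1) p w ∂(gaussianCoords (n - 1))) := by
  obtain ⟨m, rfl⟩ : ∃ m, n = m + 1 := ⟨n - 1, by omega⟩
  refine ⟨integrable_absDet _ _, ?_⟩
  have hcast : ((m + 1 : ℕ) : ℝ) - 1 = m := by push_cast; ring
  rw [Nat.add_sub_cancel, hcast]
  have hI := integral_abs_pow_gaussianReal m
  set I := ∫ t, |t| ^ m ∂gaussianReal 0 1
  have hGamma : 0 < Real.Gamma (((m : ℝ) + 1) / 2) := Real.Gamma_pos_of_pos (by positivity)
  have hIpos : 0 < I := by rw [hI]; positivity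
  have hconst : √Real.pi / ((2 : ℝ) ^ ((m : ℝ) / 2) * Real.Gamma (((m + 1 : ℕ) : ℝ) / 2)) =
      I⁻¹ := by
    rw [hI, inv_div]
    push_cast
    rfl
  rw [hconst]
  -- Either the rank-one locus is everything up to the origin, or the general formula applies.
  by_cases hX : rankOne (m + 1) p = {0}ᶜ ∧ ∫ w, absDet m p w ∂gaussianCoords m = I
  · have hae := criticalCount_ae_eq_one (by omega) hX.1
    refine ⟨aemeasurable_const.congr hae.symm, ?_⟩
    rw [lintegral_congr_ae hae, hX.2, inv_mul_cancel₀ hIpos.ne']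
    simp
  · have hmp : 1 ≤ m ∧ 2 ≤ p := by
      by_contra hcon
      apply hX
      rcases hp.eq_or_lt with rfl | hp'
      · exact ⟨rankOne_eq_compl_zero_of_degree_one, integral_absDet_one m⟩
      · obtain rfl : m = 0 := by omega
        refine ⟨rankOne_eq_compl_zero_of_dim_one hp, ?_⟩
        simp [I, absDet]
    obtain ⟨hmeas, hcount⟩ := lintegral_criticalCount hmp.1 hp
    refine ⟨hmeas, ?_⟩
    rw [lintegral_chartWeight_mul_hessMat hmp.2, ← ofReal_integral_eq_lintegral_ofReal
      (integrable_absDet m p) (ae_of_all _ fun w => abs_nonneg _)] at hcount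
    have hI0 : ENNReal.ofReal I ≠ 0 := (ENNReal.ofReal_pos.2 hIpos).ne'
    have h2 : 2 * ((∫⁻ v, criticalCount (m + 1) p v ∂stdGaussian (SymTensor (m + 1) p)) *
        ENNReal.ofReal I) = 2 * ENNReal.ofReal (∫ w, absDet m p w ∂gaussianCoords m) := by
      rw [← mul_assoc, hcount, mul_right_comm, lintegral_chartWeight_mul hmp.1]
    have h3 := (ENNReal.mul_right_inj two_ne_zero ENNReal.ofNat_ne_top).1 h2
    rw [mul_comm I⁻¹, ← div_eq_mul_inv, ENNReal.ofReal_div_of_pos hIpos,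
      ENNReal.eq_div_iff hI0 ENNReal.ofReal_ne_top, mul_comm]
    exact h3
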